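/- **Soundness of the translation of restricted permissive-nominal logic (PNL) into higher-order logic (HOL).** *PNL.* Fix a PNL signature: name sorts $\nu$, base sorts $\tau$, with sorts $\alpha ::= \nu \mid \tau \mid (\alpha_1,\dots,\alpha_n)\mid[\nu]\alpha$; term-formers $\mathsf f:(\alpha)\alpha'$ and proposition-formers $\mathsf P:\alpha$; for each $\nu$ a countably infinite set $\mathbb A_\nu$ of atoms in bijection with $\mathbb Z$ (the sets $\mathbb A_\nu$ being disjoint), the atoms with negative index forming $\mathbb A^{<}$ and the others $\mathbb A^{>}$. A permission set is a set $(\mathbb A^{<}\cup A)\setminus B$ with $A\subseteq\mathbb A^{>}$, $B\subseteq\mathbb A^{<}$ finite. For each sort $\alpha$ and permission set $S$ there are countably infinitely many unknowns $X$ with $\mathrm{sort}(X)=\alpha$, $\mathrm{pmss}(X)=S$. Let $\pi$ range over sort-preserving bijections of atoms that move finitely many atoms, and let $\mathrm{nontriv}(\pi)=\{a\mid\pi(a)\ne a\}$. Well-sorted terms and propositions are $$r::=a\mid(r_1,\dots,r_n)\mid\mathsf f(r)\mid[a]r\mid\pi\cdot X,\qquad \phi::=\bot\mid\phi\Rightarrow\phi\mid\mathsf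 P(r)\mid\forall X.\phi .$$ Permutations act by $\pi\cdot a=\pi(a)$, $\pi\cdot[a]r=[\pi(a)]\pi\cdot r$, $\pi\cdot(\pi'\cdot X)=(\pi\circ\pi')\cdot X$, and homomorphically otherwise; free atoms satisfy $\mathrm{fa}(\pi\cdot X)=\pi\cdot\mathrm{pmss}(X)$ and $\mathrm{fa}([a]r)=\mathrm{fa}(r)\setminus\{a\}$, and free unknowns $\mathrm{fU}$ are as usual with $\forall X$ binding. Syntax is quotiented by $\alpha$-equivalence: the least congruent equivalence relation with $(b\ a)\cdot r=_\alpha r$ if $a,b\notin\mathrm{fa}(r)$ (same sort), and $(Y\ X)\cdot\phi=_\alpha\phi$ if $X,Y\notin\mathrm{fU}(\phi)$ (same sort and permission set). For $r$ of the sort of $X$ with $\mathrm{fa}(r)\subseteq\mathrm{pmss}(X)$, the substitution $[X:=r]$ sends $\pi\cdot X$ to $\pi\cdot r$; it may capture atoms but avoids capture of unknowns. Sequents are pairs of sets of propositions. Derivations of restricted PNL are built from the rules $\Phi,\phi\vdash\phi,\Psi$; $\ \Phi,\bot\vdash\Psi$; the usual left and right rules for $\Rightarrow$; from $\Phi,\phi[X:=r]\vdash\Psi$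 (with $r:\mathrm{sort}(X)$, $\mathrm{fa}(r)\subseteq\mathrm{pmss}(X)$) infer $\Phi,\forall X.\phi\vdash\Psi$; from $\Phi\vdash\phi,\Psi$ with $X$ not free in $\Phi,\Psi$ infer $\Phi\vdash\forall X.\phi,\Psi$. *HOL.* Types are generated from base types, including $o$, by finite products and $\to$. Terms are simply typed $\lambda$-terms $t::= x\mid\lambda x.t\mid t\,t\mid(t,\dots,t)\mid\mathsf g$, with infinitely many variables of each type and constants $\bot:o$, $\Rightarrow:o\to o\to o$, $\forall_\beta:(\beta\to o)\to o$ and others, up to $\alpha$-equivalence. Propositions are terms of type $o$, and sequents are pairs of sets of propositions. Derivability is given by the classical sequent rules $\Xi,\xi\vdash\xi,\mathrm X$; $\ \Xi,\bot\vdash\mathrm X$; left and right rules for $\Rightarrow$; left and right rules for $\forall$ (instantiation with an arbitrary term of the type of the variable; eigenvariable not free in the context); and, on each side, replacement of a proposition by an $\alpha\beta$-equivalent one. *Translation.* The HOL signature has a base type $\mu_\nu$ for each $\nu$, $\mu_\tau$ for each $\tau$, and $o$; put $[\![\nu]\!]=\mu_\nu$, $[\![\tau]\!]=\mu_\tau$,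 $[\![(\alpha_1,\dots,\alpha_n)]\!]=([\![\alpha_1]\!],\dots,[\![\alpha_n]\!])$, $[\![[\nu]\alpha]\!]=\mu_\nu\to[\![\alpha]\!]$. It has constants $\mathsf g_{\mathsf f}:[\![\alpha]\!]\to[\![\alpha']\!]$ and $\mathsf g_{\mathsf P}:[\![\alpha]\!]\to o$. Each atom of sort $\nu$ is a variable of type $\mu_\nu$. Let $D$ be a finite list of distinct atoms, and let $D\cap S$ be the sublist of its elements in $S$. For each unknown $X$ and each $D$ there is a variable $X_D$ (these are pairwise distinct and not atoms), of type $\mu_{\nu_1}\to\dots\to\mu_{\nu_n}\to[\![\mathrm{sort}(X)]\!]$, where $\nu_1,\dots,\nu_n$ are the sorts of the successive atoms $d_1,\dots,d_n$ of $D\cap\mathrm{pmss}(X)$. Then $[\![a]\!]_D=a$, $[\![(r_i)_i]\!]_D=([\![r_i]\!]_D)_i$, $[\![\mathsf f(r)]\!]_D=\mathsf g_{\mathsf f}[\![r]\!]_D$, $[\![[a]r]\!]_D=\lambda a.[\![r]\!]_D$, $[\![\pi\cdot X]\!]_D=X_D\,\pi(d_1)\cdots\pi(d_n)$, $[\![\bot]\!]_D=\bot$,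 $[\![\phi\Rightarrow\psi]\!]_D={\Rightarrow}[\![\phi]\!]_D[\![\psi]\!]_D$, $[\![\mathsf P(r)]\!]_D=\mathsf g_{\mathsf P}[\![r]\!]_D$, $[\![\forall X.\phi]\!]_D=\forall\,\lambda X_D.[\![\phi]\!]_D$; for sets, $[\![\Phi]\!]_D=\{[\![\phi]\!]_D\mid\phi\in\Phi\}$. *Capture typing.* For a set $A$ of atoms: $D\vdash a:A$ and $D\vdash\bot:A$ always; $D\vdash[a]r:A$ iff $D\vdash r:A\cup\{a\}$; $D\vdash\pi\cdot X:A$ iff every atom in $(\mathrm{nontriv}(\pi)\cup A)\cap\mathrm{pmss}(X)$ occurs in $D$; for all other constructors, iff it holds of all immediate subterms and subpropositions with the same $A$. $D$ capture-types a sequent $\Phi'\vdash\Psi'$ if $D\vdash\phi:\varnothing$ for every $\phi\in\Phi'\cup\Psi'$. **Theorem.** Let $\mathfrak B$ be a derivation of $\Phi\vdash\Psi$ in restricted PNL. 1. For every finite list $D$ of distinct atoms that capture-types every sequent appearing in $\mathfrak B$, the sequent $[\![\Phi]\!]_D\vdash[\![\Psi]\!]_D$ is derivable in HOL. 2. If $\Phi$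 and $\Psi$ are finite, then there is a finite list $D$ of distinct atoms that capture-types every sequent appearing in $\mathfrak B$. -/

import Mathlib

universe u

noncomputable section

open Classical

/-! ## Permissive-nominal logic: sorts, atoms, signatures -/

namespace PNL

/-- The sort language over name sorts `N` and base sorts `B`. -/
inductive Srt (N B : Type u) : Type u
  | name (ν : N) : Srt N B
  | base (τ : B) : Srt N B
  | tuple (n : ℕ) (αs : Fin n → Srt N B) : Srt N B
  | abs (ν : N) (α : Srt N B) : Srt N B

/-- Atoms of all name sorts; `At ν` is the set of atoms of name sort `ν`, so that the sets of
atoms of distinct name sorts are disjoint. -/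
abbrev AtomOf {N : Type u} (At : N → Type u) : Type u := Σ ν : N, At ν

/-- The atoms with negative index, relative to chosen bijections of each `At ν` with `ℤ`. -/
def atomsDown {N : Type u} {At : N → Type u} (f : ∀ ν, At ν ≃ ℤ) : Set (AtomOf At) :=
  {a | f a.1 a.2 < 0}

/-- The atoms with nonnegative index. -/
def atomsUp {N : Type u} {At : N → Type u} (f : ∀ ν, At ν ≃ ℤ) : Set (AtomOf At) :=
  {a | 0 ≤ f a.1 a.2}

/-- Permission sets: sets of atoms of the form `(atomsDown ∪ A) \ B` with `A ⊆ atomsUp` and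
`B ⊆ atomsDown` finite. -/
def PermissionSet {N : Type u} {At : N → Type u} (f : ∀ ν, At ν ≃ ℤ) : Type u :=
  {S : Set (AtomOf At) // ∃ A B : Set (AtomOf At), A.Finite ∧ B.Finite ∧
    A ⊆ atomsUp f ∧ B ⊆ atomsDown f ∧ S = (atomsDown f ∪ A) \ B}

/-- A signature of permissive-nominal logic, together with its atoms.  A term-former `f` has arity
`(arg f) res f`, a proposition-former `P` has arity `parg P`.  The unknowns are presented as a
family: `Unk α S` is the set of unknowns of sort `α` and permission set `S`. -/
structure Signature where
  /-- name sorts -/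
  Name : Type u
  /-- base sorts -/
  Base : Type u
  /-- atoms of each name sort -/
  At : Name → Type u
  /-- the chosen bijections of the atoms with the integers -/
  idx : ∀ ν, At ν ≃ ℤ
  /-- term-formers -/
  TF : Type u
  /-- proposition-formers -/
  PF : Type u
  arg : TF → Srt Name Base
  res : TF → Srt Name Base
  parg : PF → Srt Name Base
  /-- unknowns of each sort and permission set -/
  Unk : Srt Name Base → PermissionSet idx → Type u
  unk_countable : ∀ α S, Countable (Unk α S)
  unk_infinite : ∀ α S, Infinite (Unk α S)

variable {S : Signature.{u}}

/-- Sorts of a signature. -/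
abbrev Signature.Sort' (S : Signature.{u}) : Type u := Srt S.Name S.Base

/-- Atoms of a signature. -/
abbrev Signature.Atom (S : Signature.{u}) : Type u := AtomOf S.At

/-- Permission sets of a signature. -/
abbrev Signature.Perms (S : Signature.{u}) : Type u := PermissionSet S.idx

/-- The collection of all unknowns of a signature. -/
abbrev Signature.Unknown (S : Signature.{u}) : Type u :=
  Σ (α : S.Sort') (P : S.Perms), S.Unk α P

/-- The group, under composition, of the sort-preserving bijections of atoms (given as a bijection
for each name sort) that move finitely many atoms. -/
def atomPermGroup (S : Signature.{u}) : Subgroup (∀ ν : S.Name, Equiv.Perm (S.At ν)) where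
  carrier := {π | {a : S.Atom | π a.1 a.2 ≠ a.2}.Finite}
  one_mem' := by simp
  mul_mem' := by
    intro π π' h h'
    refine (Set.Finite.union h h').subset ?_
    intro a ha
    simp only [Set.mem_ofPred_eq, Set.mem_union, Pi.mul_apply, Equiv.Perm.mul_apply] at ha ⊢
    by_contra hcon
    push Not at hcon
    rw [hcon.2, hcon.1] at ha
    exact ha rfl
  inv_mem' := by
    intro π h
    refine h.subset ?_
    intro a ha
    simp only [Set.mem_ofPred_eq, Pi.inv_apply] at ha ⊢
    intro hcon
    exact ha (by rw [Equiv.Perm.inv_eq_iff_eq]; exact hcon.symm)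

/-- Permutations of atoms. -/
def AtomPerm (S : Signature.{u}) : Type u := atomPermGroup S

instance AtomPerm.group (S : Signature.{u}) : Group (AtomPerm S) :=
  inferInstanceAs (Group (atomPermGroup S))

/-- The action of a permutation on atoms. -/
def AtomPerm.act (π : AtomPerm S) (a : S.Atom) : S.Atom := ⟨a.1, π.1 a.1 a.2⟩

/-- The atoms moved by a permutation. -/
def AtomPerm.nontriv (π : AtomPerm S) : Set S.Atom := {a | π.act a ≠ a}

/-- The swapping of two atoms of the same sort. -/
def atomSwap {ν : S.Name} (a b : S.At ν) : AtomPerm S :=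
  ⟨Pi.mulSingle ν (Equiv.swap a b), by
    refine ((Set.finite_singleton (⟨ν, a⟩ : S.Atom)).union
      (Set.finite_singleton (⟨ν, b⟩ : S.Atom))).subset ?_
    rintro ⟨ν', c⟩ hc
    by_cases hν : ν' = ν
    · subst hν
      simp only [Set.mem_ofPred_eq, Pi.mulSingle_eq_same] at hc
      by_contra hcon
      simp only [Set.mem_union, Set.mem_singleton_iff, Sigma.mk.injEq, heq_eq_eq, true_and,
        not_or] at hcon
      exact hc (Equiv.swap_apply_of_ne_of_ne hcon.1 hcon.2)
    · exact absurd (by simp [Pi.mulSingle_eq_of_ne hν]) hc⟩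

/-! ## Raw terms and propositions, actions, free atoms and unknowns -/

/-- Raw terms, indexed by their sort. -/
inductive RTerm (S : Signature.{u}) : S.Sort' → Type u
  | atom {ν : S.Name} (a : S.At ν) : RTerm S (.name ν)
  | tuple {n : ℕ} {αs : Fin n → S.Sort'} (rs : ∀ i, RTerm S (αs i)) : RTerm S (.tuple n αs)
  | app (f : S.TF) (r : RTerm S (S.arg f)) : RTerm S (S.res f)
  | abs {ν : S.Name} (a : S.At ν) {α : S.Sort'} (r : RTerm S α) : RTerm S (.abs ν α)
  | unk (π : AtomPerm S) {α : S.Sort'} {P : S.Perms} (X : S.Unk α P) : RTerm S α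

/-- Raw propositions. -/
inductive RForm (S : Signature.{u}) : Type u
  | bot : RForm S
  | imp (φ ψ : RForm S) : RForm S
  | pred (P : S.PF) (r : RTerm S (S.parg P)) : RForm S
  | all {α : S.Sort'} {P : S.Perms} (X : S.Unk α P) (φ : RForm S) : RForm S

/-- Level 1 permutation action on terms. -/
def RTerm.perm (π : AtomPerm S) : {α : S.Sort'} → RTerm S α → RTerm S α
  | _, .atom (ν := ν) a => .atom (π.1 ν a)
  | _, .tuple rs => .tuple fun i => (rs i).perm π
  | _, .app f r => .app f (r.perm π)
  | _, .abs (ν := ν) a r => .abs (π.1 ν a) (r.perm π)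
  | _, .unk π' X => .unk (π * π') X

/-- Level 1 permutation action on propositions. -/
def RForm.perm (π : AtomPerm S) : RForm S → RForm S
  | .bot => .bot
  | .imp φ ψ => .imp (φ.perm π) (ψ.perm π)
  | .pred P r => .pred P (r.perm π)
  | .all X φ => .all X (φ.perm π)

/-- Bijections on unknowns that preserve sorts and permission sets. -/
abbrev UnkPerm (S : Signature.{u}) : Type u := ∀ (α : S.Sort') (P : S.Perms), Equiv.Perm (S.Unk α P)

/-- The swapping of two unknowns of the same sort and permission set. -/
def unkSwap {α : S.Sort'} {P : S.Perms} (X Y : S.Unk α P) : UnkPerm S :=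
  Pi.mulSingle α (Pi.mulSingle P (Equiv.swap X Y))

/-- Level 2 permutation action on terms. -/
def RTerm.permU (p : UnkPerm S) : {α : S.Sort'} → RTerm S α → RTerm S α
  | _, .atom a => .atom a
  | _, .tuple rs => .tuple fun i => (rs i).permU p
  | _, .app f r => .app f (r.permU p)
  | _, .abs a r => .abs a (r.permU p)
  | _, .unk (α := α) (P := P) π X => .unk π (p α P X)

/-- Level 2 permutation action on propositions. -/
def RForm.permU (p : UnkPerm S) : RForm S → RForm S
  | .bot => .bot
  | .imp φ ψ => .imp (φ.permU p) (ψ.permU p)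
  | .pred P r => .pred P (r.permU p)
  | .all (α := α) (P := P) X φ => .all (p α P X) (φ.permU p)

/-- Free atoms of a term. -/
def RTerm.fa : {α : S.Sort'} → RTerm S α → Set S.Atom
  | _, .atom (ν := ν) a => {⟨ν, a⟩}
  | _, .tuple rs => ⋃ i, (rs i).fa
  | _, .app _ r => r.fa
  | _, .abs (ν := ν) a r => r.fa \ {⟨ν, a⟩}
  | _, .unk (P := P) π _ => π.act '' P.1

/-- Free unknowns of a term. -/
def RTerm.fU : {α : S.Sort'} → RTerm S α → Set S.Unknown
  | _, .atom _ => ∅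
  | _, .tuple rs => ⋃ i, (rs i).fU
  | _, .app _ r => r.fU
  | _, .abs _ r => r.fU
  | _, .unk (α := α) (P := P) _ X => {⟨α, P, X⟩}

/-- Free unknowns of a proposition. -/
def RForm.fU : RForm S → Set S.Unknown
  | .bot => ∅
  | .imp φ ψ => φ.fU ∪ ψ.fU
  | .pred _ r => r.fU
  | .all (α := α) (P := P) X φ => φ.fU \ {⟨α, P, X⟩}

/-! ## α-equivalence -/

/-- α-equivalence of terms. -/
inductive RTerm.Aeq : {α : S.Sort'} → RTerm S α → RTerm S α → Prop
  | refl {α : S.Sort'} (r : RTerm S α) : Aeq r r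
  | symm {α : S.Sort'} {r s : RTerm S α} : Aeq r s → Aeq s r
  | trans {α : S.Sort'} {r s t : RTerm S α} : Aeq r s → Aeq s t → Aeq r t
  | tuple {n : ℕ} {αs : Fin n → S.Sort'} {rs ss : ∀ i, RTerm S (αs i)} :
      (∀ i, Aeq (rs i) (ss i)) → Aeq (.tuple rs) (.tuple ss)
  | app {f : S.TF} {r s : RTerm S (S.arg f)} : Aeq r s → Aeq (.app f r) (.app f s)
  | abs {ν : S.Name} {a : S.At ν} {α : S.Sort'} {r s : RTerm S α} :
      Aeq r s → Aeq (.abs a r) (.abs a s)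
  | swap {ν : S.Name} {a b : S.At ν} {α : S.Sort'} {r : RTerm S α} :
      (⟨ν, a⟩ : S.Atom) ∉ r.fa → (⟨ν, b⟩ : S.Atom) ∉ r.fa → Aeq (r.perm (atomSwap b a)) r

/-- α-equivalence of propositions. -/
inductive RForm.Aeq : RForm S → RForm S → Prop
  | refl (φ : RForm S) : Aeq φ φ
  | symm {φ ψ : RForm S} : Aeq φ ψ → Aeq ψ φ
  | trans {φ ψ χ : RForm S} : Aeq φ ψ → Aeq ψ χ → Aeq φ χ
  | imp {φ φ' ψ ψ' : RForm S} : Aeq φ φ' → Aeq ψ ψ' → Aeq (.imp φ ψ) (.imp φ' ψ')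
  | pred {P : S.PF} {r s : RTerm S (S.parg P)} : r.Aeq s → Aeq (.pred P r) (.pred P s)
  | all {α : S.Sort'} {P : S.Perms} {X : S.Unk α P} {φ φ' : RForm S} :
      Aeq φ φ' → Aeq (.all X φ) (.all X φ')
  | swap {α : S.Sort'} {P : S.Perms} {X Y : S.Unk α P} {φ : RForm S} :
      (⟨α, P, X⟩ : S.Unknown) ∉ φ.fU → (⟨α, P, Y⟩ : S.Unknown) ∉ φ.fU →
        Aeq (φ.permU (unkSwap Y X)) φ

instance RForm.setoid (S : Signature.{u}) : Setoid (RForm S) where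
  r := RForm.Aeq
  iseqv := ⟨.refl, .symm, .trans⟩

/-- Propositions: raw propositions up to α-equivalence. -/
def Form (S : Signature.{u}) : Type u := Quotient (RForm.setoid S)

/-- The α-equivalence class of a raw proposition. -/
def RForm.cls (φ : RForm S) : Form S := Quotient.mk _ φ

/-- Falsity on classes. -/
def Form.bot : Form S := RForm.bot.cls

/-- Implication on classes. -/
def Form.imp : Form S → Form S → Form S :=
  Quotient.map₂ RForm.imp fun _ _ h _ _ h' => RForm.Aeq.imp h h'

/-- Universal quantification on classes. -/
def Form.all {α : S.Sort'} {P : S.Perms} (X : S.Unk α P) : Form S → Form S :=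
  Quotient.map (RForm.all X) fun _ _ h => RForm.Aeq.all h

/-! ### Free unknowns of classes -/

theorem RTerm.fU_perm (π : AtomPerm S) {α : S.Sort'} (r : RTerm S α) : (r.perm π).fU = r.fU := by
  induction r with
  | atom a => rfl
  | tuple rs ih => simp only [RTerm.perm, RTerm.fU, ih]
  | app f r ih => simpa only [RTerm.perm, RTerm.fU] using ih
  | abs a r ih => simpa only [RTerm.perm, RTerm.fU] using ih
  | unk π' X => rfl

theorem RTerm.Aeq.fU_eq {α : S.Sort'} {r s : RTerm S α} (h : r.Aeq s) : r.fU = s.fU := by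
  induction h with
  | refl r => rfl
  | symm _ ih => exact ih.symm
  | trans _ _ ih ih' => exact ih.trans ih'
  | tuple _ ih => simp only [RTerm.fU, ih]
  | app _ ih => exact ih
  | abs _ ih => exact ih
  | swap _ _ => exact RTerm.fU_perm _ _

/-- The action on unknowns of a level 2 permutation. -/
def UnkPerm.act (p : UnkPerm S) (X : S.Unknown) : S.Unknown := ⟨X.1, X.2.1, p X.1 X.2.1 X.2.2⟩

theorem UnkPerm.act_injective (p : UnkPerm S) : Function.Injective p.act := by
  rintro ⟨α, P, X⟩ ⟨α', P', X'⟩ h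
  simp only [UnkPerm.act, Sigma.mk.injEq] at h
  obtain ⟨rfl, h⟩ := h
  simp only [heq_eq_eq, Sigma.mk.injEq] at h
  obtain ⟨rfl, h⟩ := h
  simpa using h

theorem UnkPerm.act_unkSwap_of_ne {α : S.Sort'} {P : S.Perms} {X Y : S.Unk α P} {Z : S.Unknown}
    (hX : Z ≠ ⟨α, P, X⟩) (hY : Z ≠ ⟨α, P, Y⟩) : UnkPerm.act (unkSwap Y X) Z = Z := by
  obtain ⟨α', P', Z⟩ := Z
  by_cases hα : α' = α
  · subst hα
    by_cases hP : P' = P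
    · subst hP
      have h1 : Z ≠ X := fun h => hX (by rw [h])
      have h2 : Z ≠ Y := fun h => hY (by rw [h])
      simp only [UnkPerm.act, unkSwap, Pi.mulSingle_eq_same, Equiv.swap_apply_of_ne_of_ne h2 h1]
    · simp [UnkPerm.act, unkSwap, Pi.mulSingle_eq_of_ne hP]
  · simp [UnkPerm.act, unkSwap, Pi.mulSingle_eq_of_ne hα]

theorem RTerm.fU_permU (p : UnkPerm S) {α : S.Sort'} (r : RTerm S α) :
    (r.permU p).fU = p.act '' r.fU := by
  induction r with
  | atom a => simp [RTerm.permU, RTerm.fU]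
  | tuple rs ih => simp only [RTerm.permU, RTerm.fU, ih, Set.image_iUnion]
  | app f r ih => simpa only [RTerm.permU, RTerm.fU] using ih
  | abs a r ih => simpa only [RTerm.permU, RTerm.fU] using ih
  | unk π' X => simp [RTerm.permU, RTerm.fU, UnkPerm.act]

theorem RForm.fU_permU (p : UnkPerm S) (φ : RForm S) : (φ.permU p).fU = p.act '' φ.fU := by
  induction φ with
  | bot => simp [RForm.permU, RForm.fU]
  | imp φ ψ ih ih' => simp only [RForm.permU, RForm.fU, ih, ih', Set.image_union]
  | pred P r => exact RTerm.fU_permU p r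
  | all X φ ih =>
    simp only [RForm.permU, RForm.fU, ih, Set.image_sdiff p.act_injective, Set.image_singleton,
      UnkPerm.act]

theorem RForm.Aeq.fU_eq {φ ψ : RForm S} (h : φ.Aeq ψ) : φ.fU = ψ.fU := by
  induction h with
  | refl r => rfl
  | symm _ ih => exact ih.symm
  | trans _ _ ih ih' => exact ih.trans ih'
  | imp _ _ ih ih' => simp only [RForm.fU, ih, ih']
  | pred h => exact h.fU_eq
  | all _ ih => simp only [RForm.fU, ih]
  | swap hX hY =>
    rw [RForm.fU_permU]
    refine Eq.trans (Set.image_congr fun Z hZ => ?_) (Set.image_id _)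
    exact UnkPerm.act_unkSwap_of_ne (fun h => hX (h ▸ hZ)) (fun h => hY (h ▸ hZ))

/-- Free unknowns of a proposition. -/
def Form.fU : Form S → Set S.Unknown := Quotient.lift RForm.fU fun _ _ h => RForm.Aeq.fU_eq h

/-! ## Substitution -/

/-- Level 2 substitutions. -/
structure Subst (S : Signature.{u}) where
  toFun : ∀ X : S.Unknown, RTerm S X.1
  fa_subset : ∀ X : S.Unknown, (toFun X).fa ⊆ X.2.1.1
  finite_nontriv : {X : S.Unknown | ¬ (toFun X).Aeq (.unk 1 X.2.2)}.Finite

/-- The unknowns produced or consumed by a substitution other than in the trivial manner. -/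
def Subst.nontriv (θ : Subst S) : Set S.Unknown :=
  {X | ¬ (θ.toFun X).Aeq (.unk 1 X.2.2) ∨ ∃ Y, Y ≠ X ∧ X ∈ (θ.toFun Y).fU}

/-- Substitution action on raw terms. -/
def RTerm.subst (θ : Subst S) : {α : S.Sort'} → RTerm S α → RTerm S α
  | _, .atom a => .atom a
  | _, .tuple rs => .tuple fun i => (rs i).subst θ
  | _, .app f r => .app f (r.subst θ)
  | _, .abs a r => .abs a (r.subst θ)
  | _, .unk (α := α) (P := P) π X => (θ.toFun ⟨α, P, X⟩).perm π

/-- Substitution action on raw propositions.  It is only meaningful when no bound unknown of the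
proposition is in `θ.nontriv`, which is required (`RForm.BoundAvoids`) wherever it is used; every
α-equivalence class has such representatives. -/
def RForm.subst (θ : Subst S) : RForm S → RForm S
  | .bot => .bot
  | .imp φ ψ => .imp (φ.subst θ) (ψ.subst θ)
  | .pred P r => .pred P (r.subst θ)
  | .all X φ => .all X (φ.subst θ)

/-- No unknown in `V` is quantified in the raw proposition. -/
def RForm.BoundAvoids (V : Set S.Unknown) : RForm S → Prop
  | .bot => True
  | .imp φ ψ => φ.BoundAvoids V ∧ ψ.BoundAvoids V
  | .pred _ _ => True
  | .all (α := α) (P := P) X φ => (⟨α, P, X⟩ : S.Unknown) ∉ V ∧ φ.BoundAvoids V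

/-- The substitution `[X := r]`. -/
def Subst.single {α : S.Sort'} {P : S.Perms} (X : S.Unk α P) (r : RTerm S α) (h : r.fa ⊆ P.1) :
    Subst S where
  toFun := Function.update (fun Y : S.Unknown => RTerm.unk 1 Y.2.2) ⟨α, P, X⟩ r
  fa_subset := by
    intro Y
    by_cases hY : Y = ⟨α, P, X⟩
    · subst hY
      simpa using h
    · rw [Function.update_of_ne hY]
      rintro _ ⟨a, ha, rfl⟩
      exact ha
  finite_nontriv := by
    refine (Set.finite_singleton (⟨α, P, X⟩ : S.Unknown)).subset ?_
    intro Y hY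
    by_contra hne
    refine hY ?_
    rw [Function.update_of_ne (by simpa using hne)]
    exact .refl _

/-! ## Derivations of restricted permissive-nominal logic -/

/-- Derivations in restricted permissive-nominal logic of the sequent with the two given sets of
propositions. -/
inductive Deriv : Set (Form S) → Set (Form S) → Type u
  | ax (Φ Ψ : Set (Form S)) (φ : Form S) : Deriv (insert φ Φ) (insert φ Ψ)
  | botL (Φ Ψ : Set (Form S)) : Deriv (insert .bot Φ) Ψ
  | impL (Φ Ψ : Set (Form S)) (φ ψ : Form S) :
      Deriv Φ (insert φ Ψ) → Deriv (insert ψ Φ) Ψ → Deriv (insert (.imp φ ψ) Φ) Ψ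
  | impR (Φ Ψ : Set (Form S)) (φ ψ : Form S) :
      Deriv (insert φ Φ) (insert ψ Ψ) → Deriv Φ (insert (.imp φ ψ) Ψ)
  | allL (Φ Ψ : Set (Form S)) {α : S.Sort'} {P : S.Perms} (X : S.Unk α P) (φ : RForm S)
      (r : RTerm S α) (hr : r.fa ⊆ P.1) (hφ : φ.BoundAvoids (Subst.single X r hr).nontriv) :
      Deriv (insert (φ.subst (.single X r hr)).cls Φ) Ψ → Deriv (insert (.all X φ.cls) Φ) Ψ
  | allR (Φ Ψ : Set (Form S)) {α : S.Sort'} {P : S.Perms} (X : S.Unk α P) (φ : Form S)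
      (hΦ : ∀ χ ∈ Φ, (⟨α, P, X⟩ : S.Unknown) ∉ χ.fU)
      (hΨ : ∀ χ ∈ Ψ, (⟨α, P, X⟩ : S.Unknown) ∉ χ.fU) :
      Deriv Φ (insert φ Ψ) → Deriv Φ (insert (.all X φ) Ψ)

/-- The sequents appearing in a derivation (its conclusion included). -/
def Deriv.sequents : {Φ Ψ : Set (Form S)} → Deriv Φ Ψ → Set (Set (Form S) × Set (Form S))
  | _, _, .ax Φ Ψ φ => {(insert φ Φ, insert φ Ψ)}
  | _, _, .botL Φ Ψ => {(insert .bot Φ, Ψ)}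
  | _, _, .impL Φ Ψ φ ψ B B' => insert (insert (.imp φ ψ) Φ, Ψ) (B.sequents ∪ B'.sequents)
  | _, _, .impR Φ Ψ φ ψ B => insert (Φ, insert (.imp φ ψ) Ψ) B.sequents
  | _, _, .allL Φ Ψ X φ _ _ _ B => insert (insert (.all X φ.cls) Φ, Ψ) B.sequents
  | _, _, .allR Φ Ψ X φ _ _ B => insert (Φ, insert (.all X φ) Ψ) B.sequents

/-! ## Capture typing -/

/-- Capture typing `D ⊢ r : A` of terms. -/
def RTerm.Capt (D : List S.Atom) : {α : S.Sort'} → RTerm S α → Set S.Atom → Prop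
  | _, .atom _, _ => True
  | _, .tuple rs, A => ∀ i, (rs i).Capt D A
  | _, .app _ r, A => r.Capt D A
  | _, .abs (ν := ν) a r, A => r.Capt D (insert ⟨ν, a⟩ A)
  | _, .unk (P := P) π _, A => ∀ a ∈ (π.nontriv ∪ A) ∩ P.1, a ∈ D

/-- Capture typing `D ⊢ φ : A` of propositions. -/
def RForm.Capt (D : List S.Atom) : RForm S → Set S.Atom → Prop
  | .bot, _ => True
  | .imp φ ψ, A => φ.Capt D A ∧ ψ.Capt D A
  | .pred _ r, A => r.Capt D A
  | .all _ φ, A => φ.Capt D A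

/-! ### Capture typing respects α-equivalence -/

theorem AtomPerm.act_mul (π π' : AtomPerm S) (a : S.Atom) :
    (π * π').act a = π.act (π'.act a) := rfl

theorem AtomPerm.act_injective (π : AtomPerm S) : Function.Injective π.act := by
  rintro ⟨ν, a⟩ ⟨ν', b⟩ h
  simp only [AtomPerm.act, Sigma.mk.injEq] at h
  obtain ⟨rfl, h⟩ := h
  simpa using h

theorem AtomPerm.act_atomSwap_of_ne {ν : S.Name} {a b : S.At ν} {c : S.Atom}
    (ha : c ≠ ⟨ν, a⟩) (hb : c ≠ ⟨ν, b⟩) : (atomSwap b a).act c = c := by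
  obtain ⟨ν', c⟩ := c
  by_cases hν : ν' = ν
  · subst hν
    have h1 : c ≠ a := fun h => ha (by rw [h])
    have h2 : c ≠ b := fun h => hb (by rw [h])
    simp only [AtomPerm.act, atomSwap, Pi.mulSingle_eq_same, Equiv.swap_apply_of_ne_of_ne h2 h1]
  · simp [AtomPerm.act, atomSwap, Pi.mulSingle_eq_of_ne hν]

theorem RTerm.capt_perm (D : List S.Atom) (π : AtomPerm S) {α : S.Sort'} (r : RTerm S α)
    (A A' : Set S.Atom)
    (h : ∀ c ∈ r.fa, ∀ s, (π.act c = s ∧ s ∉ A) ↔ (c = s ∧ s ∉ A')) :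
    (r.perm π).Capt D A ↔ r.Capt D A' := by
  induction r generalizing A A' with
  | atom a => simp [RTerm.perm, RTerm.Capt]
  | tuple rs ih =>
    simp only [RTerm.perm, RTerm.Capt]
    exact forall_congr' fun i => ih i A A' fun c hc => h c (Set.mem_iUnion.2 ⟨i, hc⟩)
  | app f r ih => exact ih A A' h
  | abs a r ih =>
    rename_i ν α
    refine ih _ _ fun c hc s => ?_
    by_cases hca : c = ⟨ν, a⟩
    · subst hca
      constructor
      · rintro ⟨rfl, hs⟩
        exact absurd (Set.mem_insert _ _) hs
      · rintro ⟨rfl, hs⟩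
        exact absurd (Set.mem_insert _ _) hs
    · have hc' := h c ⟨hc, hca⟩
      have hne : π.act c ≠ ⟨ν, π.1 ν a⟩ := fun h => hca (π.act_injective h)
      constructor
      · rintro ⟨rfl, hs⟩
        have := (hc' _).1 ⟨rfl, fun h => hs (Set.mem_insert_of_mem _ h)⟩
        refine ⟨this.1, fun h => ?_⟩
        rcases h with h | h
        · exact hca (this.1.trans h)
        · exact this.2 h
      · rintro ⟨rfl, hs⟩
        have := (hc' _).2 ⟨rfl, fun h => hs (Set.mem_insert_of_mem _ h)⟩
        refine ⟨this.1, fun h => ?_⟩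
        rcases h with h | h
        · exact hne (this.1.trans h)
        · exact this.2 h
  | unk π' X =>
    simp only [RTerm.perm, RTerm.Capt]
    refine forall_congr' fun s => ?_
    refine imp_congr_left ?_
    simp only [Set.mem_inter_iff, Set.mem_union, AtomPerm.nontriv, Set.mem_ofPred_eq]
    refine and_congr_left fun hs => ?_
    have := not_congr (h (π'.act s) ⟨s, hs, rfl⟩ s)
    simpa only [AtomPerm.act_mul, not_and_or, not_not] using this

theorem RTerm.Aeq.capt_iff (D : List S.Atom) {α : S.Sort'} {r s : RTerm S α} (h : r.Aeq s)
    (A : Set S.Atom) : r.Capt D A ↔ s.Capt D A := by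
  induction h generalizing A with
  | refl r => rfl
  | symm _ ih => exact (ih A).symm
  | trans _ _ ih ih' => exact (ih A).trans (ih' A)
  | tuple _ ih => exact forall_congr' fun i => ih i A
  | app _ ih => exact ih A
  | abs _ ih => exact ih _
  | swap ha hb =>
    refine RTerm.capt_perm D _ _ A A fun c hc s => ?_
    rw [AtomPerm.act_atomSwap_of_ne (fun h => ha (h ▸ hc)) (fun h => hb (h ▸ hc))]

theorem RTerm.capt_permU (D : List S.Atom) (p : UnkPerm S) {α : S.Sort'} (r : RTerm S α)
    (A : Set S.Atom) : (r.permU p).Capt D A ↔ r.Capt D A := by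
  induction r generalizing A with
  | atom a => rfl
  | tuple rs ih => exact forall_congr' fun i => ih i A
  | app f r ih => exact ih A
  | abs a r ih => exact ih _
  | unk π' X => rfl

theorem RForm.capt_permU (D : List S.Atom) (p : UnkPerm S) (φ : RForm S) (A : Set S.Atom) :
    (φ.permU p).Capt D A ↔ φ.Capt D A := by
  induction φ with
  | bot => rfl
  | imp φ ψ ih ih' => exact and_congr ih ih'
  | pred P r => exact RTerm.capt_permU D p r A
  | all X φ ih => exact ih

theorem RForm.Aeq.capt_iff (D : List S.Atom) {φ ψ : RForm S} (h : φ.Aeq ψ) (A : Set S.Atom) :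
    φ.Capt D A ↔ ψ.Capt D A := by
  induction h with
  | refl r => rfl
  | symm _ ih => exact ih.symm
  | trans _ _ ih ih' => exact ih.trans ih'
  | imp _ _ ih ih' => exact and_congr ih ih'
  | pred h => exact h.capt_iff D A
  | all _ ih => exact ih
  | swap _ _ => exact RForm.capt_permU D _ _ A

/-- Capture typing `D ⊢ φ : A` of propositions up to α-equivalence. -/
def Form.Capt (D : List S.Atom) (φ : Form S) (A : Set S.Atom) : Prop :=
  Quotient.lift (fun φ : RForm S => φ.Capt D A)
    (fun _ _ h => propext (RForm.Aeq.capt_iff D h A)) φ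

/-- `D` capture-types every proposition in a set, with the empty set of abstracted atoms. -/
def CaptSet (D : List S.Atom) (Φ : Set (Form S)) : Prop := ∀ φ ∈ Φ, φ.Capt D ∅

end PNL

/-! ## Higher-order logic -/

namespace HOL

/-- The type language over a set of base types. -/
inductive Ty (B : Type u) : Type u
  | base (b : B) : Ty B
  | tuple (n : ℕ) (βs : Fin n → Ty B) : Ty B
  | arrow (β' β : Ty B) : Ty B

/-- A signature of higher-order logic together with its variables.  Constants and variables are
presented as families indexed by their type; there are infinitely many variables of each type. -/
structure Signature where
  /-- base types -/
  Base : Type u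
  /-- the base type of truth-values -/
  o : Base
  /-- constants of each type -/
  Const : Ty Base → Type u
  bot : Const (.base o)
  imp : Const (.arrow (.base o) (.arrow (.base o) (.base o)))
  all : ∀ β : Ty Base, Const (.arrow (.arrow β (.base o)) (.base o))
  /-- variables of each type -/
  Var : Ty Base → Type u
  var_infinite : ∀ β, Infinite (Var β)

variable {T : Signature.{u}}

/-- Types of a signature. -/
abbrev Signature.Typ (T : Signature.{u}) : Type u := Ty T.Base

/-- The type of truth-values. -/
abbrev Signature.omega (T : Signature.{u}) : T.Typ := .base T.o

/-- The collection of all variables of a signature. -/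
abbrev Signature.Variable (T : Signature.{u}) : Type u := Σ β : T.Typ, T.Var β

/-- Raw typable terms, indexed by their type. -/
inductive RTm (T : Signature.{u}) : T.Typ → Type u
  | var {β : T.Typ} (x : T.Var β) : RTm T β
  | lam {β' β : T.Typ} (x : T.Var β') (t : RTm T β) : RTm T (.arrow β' β)
  | app {β' β : T.Typ} (t' : RTm T (.arrow β' β)) (t : RTm T β') : RTm T β
  | tuple {n : ℕ} {βs : Fin n → T.Typ} (ts : ∀ i, RTm T (βs i)) : RTm T (.tuple n βs)
  | const {β : T.Typ} (g : T.Const β) : RTm T β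

/-- Type-preserving bijections on variables. -/
abbrev VarPerm (T : Signature.{u}) : Type u := ∀ β : T.Typ, Equiv.Perm (T.Var β)

/-- The swapping of two variables of the same type. -/
def varSwap {β : T.Typ} (x y : T.Var β) : VarPerm T := Pi.mulSingle β (Equiv.swap x y)

/-- The permutation action on terms. -/
def RTm.perm (p : VarPerm T) : {β : T.Typ} → RTm T β → RTm T β
  | β, .var x => .var (p β x)
  | _, .lam (β' := β') x t => .lam (p β' x) (t.perm p)
  | _, .app t' t => .app (t'.perm p) (t.perm p)
  | _, .tuple ts => .tuple fun i => (ts i).perm p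
  | _, .const g => .const g

/-- Free variables of a term. -/
def RTm.fv : {β : T.Typ} → RTm T β → Set T.Variable
  | β, .var x => {⟨β, x⟩}
  | _, .lam (β' := β') x t => t.fv \ {⟨β', x⟩}
  | _, .app t' t => t'.fv ∪ t.fv
  | _, .tuple ts => ⋃ i, (ts i).fv
  | _, .const _ => ∅

/-- α-equivalence. -/
inductive RTm.Aeq : {β : T.Typ} → RTm T β → RTm T β → Prop
  | refl {β : T.Typ} (t : RTm T β) : Aeq t t
  | symm {β : T.Typ} {t u : RTm T β} : Aeq t u → Aeq u t
  | trans {β : T.Typ} {t u v : RTm T β} : Aeq t u → Aeq u v → Aeq t v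
  | lam {β' β : T.Typ} {x : T.Var β'} {t u : RTm T β} : Aeq t u → Aeq (.lam x t) (.lam x u)
  | app {β' β : T.Typ} {t' u' : RTm T (.arrow β' β)} {t u : RTm T β'} :
      Aeq t' u' → Aeq t u → Aeq (.app t' t) (.app u' u)
  | tuple {n : ℕ} {βs : Fin n → T.Typ} {ts us : ∀ i, RTm T (βs i)} :
      (∀ i, Aeq (ts i) (us i)) → Aeq (.tuple ts) (.tuple us)
  | swap {β' β : T.Typ} {x y : T.Var β'} {t : RTm T β} :
      (⟨β', x⟩ : T.Variable) ∉ t.fv → (⟨β', y⟩ : T.Variable) ∉ t.fv →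
        Aeq (t.perm (varSwap y x)) t

instance RTm.setoid (T : Signature.{u}) (β : T.Typ) : Setoid (RTm T β) where
  r := RTm.Aeq
  iseqv := ⟨.refl, .symm, .trans⟩

/-- No variable in `V` is λ-bound in the raw term. -/
def RTm.BoundAvoids (V : Set T.Variable) : {β : T.Typ} → RTm T β → Prop
  | _, .var _ => True
  | _, .lam (β' := β') x t => (⟨β', x⟩ : T.Variable) ∉ V ∧ t.BoundAvoids V
  | _, .app t' t => t'.BoundAvoids V ∧ t.BoundAvoids V
  | _, .tuple ts => ∀ i, (ts i).BoundAvoids V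
  | _, .const _ => True

/-- Substitution `t[x := u]` of a term for a variable in a raw term.  It is only meaningful when the
bound variables of `t` are distinct from `x` and not free in `u`, which is required
(`RTm.CanSubst`) wherever it is used; every α-equivalence class has such representatives. -/
def RTm.subst {β' : T.Typ} (x : T.Var β') (u : RTm T β') : {β : T.Typ} → RTm T β → RTm T β
  | β, .var y => Function.update (fun z : T.Variable => (RTm.var z.2 : RTm T z.1)) ⟨β', x⟩ u ⟨β, y⟩
  | _, .lam y t => .lam y (RTm.subst x u t)
  | _, .app t' t => .app (RTm.subst x u t') (RTm.subst x u t)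
  | _, .tuple ts => .tuple fun i => RTm.subst x u (ts i)
  | _, .const g => .const g

/-- The bound variables of `t` are distinct from `x` and not free in `u`. -/
def RTm.CanSubst {β' β : T.Typ} (t : RTm T β) (x : T.Var β') (u : RTm T β') : Prop :=
  t.BoundAvoids (insert ⟨β', x⟩ u.fv)

/-- αβ-equivalence. -/
inductive RTm.ABeq : {β : T.Typ} → RTm T β → RTm T β → Prop
  | alpha {β : T.Typ} {t u : RTm T β} : t.Aeq u → ABeq t u
  | symm {β : T.Typ} {t u : RTm T β} : ABeq t u → ABeq u t
  | trans {β : T.Typ} {t u v : RTm T β} : ABeq t u → ABeq u v → ABeq t v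
  | lam {β' β : T.Typ} {x : T.Var β'} {t u : RTm T β} : ABeq t u → ABeq (.lam x t) (.lam x u)
  | app {β' β : T.Typ} {t' u' : RTm T (.arrow β' β)} {t u : RTm T β'} :
      ABeq t' u' → ABeq t u → ABeq (.app t' t) (.app u' u)
  | tuple {n : ℕ} {βs : Fin n → T.Typ} {ts us : ∀ i, RTm T (βs i)} :
      (∀ i, ABeq (ts i) (us i)) → ABeq (.tuple ts) (.tuple us)
  | beta {β' β : T.Typ} (x : T.Var β') (u : RTm T β') (t : RTm T β) :
      t.CanSubst x u → ABeq (.app (.lam x t) u) (RTm.subst x u t)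

/-- The raw term `ξ → χ`. -/
def RTm.impl (ξ χ : RTm T T.omega) : RTm T T.omega := .app (.app (.const T.imp) ξ) χ

/-- The raw term `∀ x, ξ`. -/
def RTm.forAll {β : T.Typ} (x : T.Var β) (ξ : RTm T T.omega) : RTm T T.omega :=
  .app (.const (T.all β)) (.lam x ξ)

/-- Propositions of higher-order logic: raw terms of the type of truth-values, up to
α-equivalence. -/
def Form (T : Signature.{u}) : Type u := Quotient (RTm.setoid T T.omega)

/-- The α-equivalence class of a raw proposition. -/
def RTm.cls (ξ : RTm T T.omega) : Form T := Quotient.mk _ ξ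

/-- Falsity on classes. -/
def Form.bot : Form T := (RTm.const T.bot).cls

/-- Implication on classes. -/
def Form.imp : Form T → Form T → Form T :=
  Quotient.map₂ RTm.impl fun _ _ h _ _ h' => RTm.Aeq.app (RTm.Aeq.app (.refl _) h) h'

/-- Universal quantification on classes. -/
def Form.all {β : T.Typ} (x : T.Var β) : Form T → Form T :=
  Quotient.map (RTm.forAll x) fun _ _ h => RTm.Aeq.app (.refl _) (RTm.Aeq.lam h)

/-! ### Free variables of classes -/

/-- The action on variables. -/
def VarPerm.act (p : VarPerm T) (x : T.Variable) : T.Variable := ⟨x.1, p x.1 x.2⟩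

theorem VarPerm.act_injective (p : VarPerm T) : Function.Injective p.act := by
  rintro ⟨α, X⟩ ⟨α', X'⟩ h
  simp only [VarPerm.act, Sigma.mk.injEq] at h
  obtain ⟨rfl, h⟩ := h
  simpa using h

theorem VarPerm.act_varSwap_of_ne {β : T.Typ} {x y : T.Var β} {z : T.Variable}
    (hx : z ≠ ⟨β, x⟩) (hy : z ≠ ⟨β, y⟩) : VarPerm.act (varSwap y x) z = z := by
  obtain ⟨β', z⟩ := z
  by_cases hβ : β' = β
  · subst hβ
    have h1 : z ≠ x := fun h => hx (by rw [h])
    have h2 : z ≠ y := fun h => hy (by rw [h])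
    simp only [VarPerm.act, varSwap, Pi.mulSingle_eq_same, Equiv.swap_apply_of_ne_of_ne h2 h1]
  · simp [VarPerm.act, varSwap, Pi.mulSingle_eq_of_ne hβ]

theorem RTm.fv_perm (p : VarPerm T) {β : T.Typ} (t : RTm T β) : (t.perm p).fv = p.act '' t.fv := by
  induction t with
  | var x => simp [RTm.perm, RTm.fv, VarPerm.act]
  | lam x t ih =>
    simp only [RTm.perm, RTm.fv, ih, Set.image_sdiff p.act_injective, Set.image_singleton,
      VarPerm.act]
  | app t' t ih' ih => simp only [RTm.perm, RTm.fv, ih, ih', Set.image_union]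
  | tuple ts ih => simp only [RTm.perm, RTm.fv, ih, Set.image_iUnion]
  | const g => simp [RTm.perm, RTm.fv]

theorem RTm.Aeq.fv_eq {β : T.Typ} {t u : RTm T β} (h : t.Aeq u) : t.fv = u.fv := by
  induction h with
  | refl t => rfl
  | symm _ ih => exact ih.symm
  | trans _ _ ih ih' => exact ih.trans ih'
  | lam _ ih => simp only [RTm.fv, ih]
  | app _ _ ih' ih => simp only [RTm.fv, ih, ih']
  | tuple _ ih => simp only [RTm.fv, ih]
  | swap hx hy =>
    rw [RTm.fv_perm]
    refine Eq.trans (Set.image_congr fun z hz => ?_) (Set.image_id _)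
    exact VarPerm.act_varSwap_of_ne (fun h => hx (h ▸ hz)) (fun h => hy (h ▸ hz))

/-- Free variables of a proposition. -/
def Form.fv : Form T → Set T.Variable := Quotient.lift RTm.fv fun _ _ h => RTm.Aeq.fv_eq h

/-! ### Derivability -/

/-- Derivable sequents of higher-order logic.  Propositions are taken up to αβ-equivalence: the
sequent rules are stated for α-equivalence classes, and `convL`, `convR` replace a proposition on
the left or on the right by an αβ-equivalent one. -/
inductive Derivable : Set (Form T) → Set (Form T) → Prop
  | ax (Ξ Χ : Set (Form T)) (ξ : Form T) : Derivable (insert ξ Ξ) (insert ξ Χ)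
  | botL (Ξ Χ : Set (Form T)) : Derivable (insert .bot Ξ) Χ
  | impL (Ξ Χ : Set (Form T)) (ξ χ : Form T) :
      Derivable Ξ (insert ξ Χ) → Derivable (insert χ Ξ) Χ → Derivable (insert (.imp ξ χ) Ξ) Χ
  | impR (Ξ Χ : Set (Form T)) (ξ χ : Form T) :
      Derivable (insert ξ Ξ) (insert χ Χ) → Derivable Ξ (insert (.imp ξ χ) Χ)
  | allL (Ξ Χ : Set (Form T)) {β : T.Typ} (x : T.Var β) (ξ : RTm T T.omega) (t : RTm T β)
      (h : ξ.CanSubst x t) :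
      Derivable (insert (RTm.subst x t ξ).cls Ξ) Χ → Derivable (insert (.all x ξ.cls) Ξ) Χ
  | allR (Ξ Χ : Set (Form T)) {β : T.Typ} (x : T.Var β) (ξ : Form T)
      (hΞ : ∀ χ ∈ Ξ, (⟨β, x⟩ : T.Variable) ∉ χ.fv)
      (hΧ : ∀ χ ∈ Χ, (⟨β, x⟩ : T.Variable) ∉ χ.fv) :
      Derivable Ξ (insert ξ Χ) → Derivable Ξ (insert (.all x ξ) Χ)
  | convL (Ξ Χ : Set (Form T)) (ξ ξ' : RTm T T.omega) :
      ξ.ABeq ξ' → Derivable (insert ξ.cls Ξ) Χ → Derivable (insert ξ'.cls Ξ) Χ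
  | convR (Ξ Χ : Set (Form T)) (ξ ξ' : RTm T T.omega) :
      ξ.ABeq ξ' → Derivable Ξ (insert ξ.cls Χ) → Derivable Ξ (insert ξ'.cls Χ)

end HOL

/-! ## The translation -/

namespace PNL

variable {S : Signature.{u}}

/-- The base types of the translated signature. -/
inductive HBase (S : Signature.{u}) : Type u
  | o : HBase S
  | name (ν : S.Name) : HBase S
  | base (τ : S.Base) : HBase S

/-- Translation of sorts to types. -/
def trSort : S.Sort' → HOL.Ty (HBase S)
  | .name ν => .base (.name ν)
  | .base τ => .base (.base τ)
  | .tuple n αs => .tuple n fun i => trSort (αs i)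
  | .abs ν α => .arrow (.base (.name ν)) (trSort α)

/-- The type `μ₁ → ⋯ → μₙ → β` where `μᵢ` is the type of the `i`th atom in the list. -/
def arrows : List S.Atom → HOL.Ty (HBase S) → HOL.Ty (HBase S)
  | [], β => β
  | a :: D, β => .arrow (.base (.name a.1)) (arrows D β)

/-- The sublist of `D` of the atoms in the permission set `P`. -/
def restr (D : List S.Atom) (P : S.Perms) : List S.Atom := D.filter fun a => decide (a ∈ P.1)

/-- The constants of the translated signature, by type. -/
inductive HConst (S : Signature.{u}) : HOL.Ty (HBase S) → Type u
  | bot : HConst S (.base .o)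
  | imp : HConst S (.arrow (.base .o) (.arrow (.base .o) (.base .o)))
  | all (β : HOL.Ty (HBase S)) : HConst S (.arrow (.arrow β (.base .o)) (.base .o))
  | tf (f : S.TF) : HConst S (.arrow (trSort (S.arg f)) (trSort (S.res f)))
  | pf (P : S.PF) : HConst S (.arrow (trSort (S.parg P)) (.base .o))

/-- The variables of the translated signature: atoms, a variable `X_D` for each unknown `X` and
list `D`, and infinitely many further variables of each type. -/
inductive HVar (S : Signature.{u}) : Type u
  | atom (a : S.Atom) : HVar S
  | unk (X : S.Unknown) (D : List S.Atom) : HVar S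
  | other (β : HOL.Ty (HBase S)) (n : ℕ) : HVar S

/-- The type of a variable. -/
def HVar.type : HVar S → HOL.Ty (HBase S)
  | .atom a => .base (.name a.1)
  | .unk X D => arrows (restr D X.2.1) (trSort X.1)
  | .other β _ => β

/-- The signature of higher-order logic determined by a signature of permissive-nominal logic. -/
@[reducible] def Signature.hol (S : Signature.{u}) : HOL.Signature.{u} where
  Base := HBase S
  o := .o
  Const := HConst S
  bot := .bot
  imp := .imp
  all := .all
  Var β := {x : HVar S // x.type = β}
  var_infinite β := Infinite.of_injective
    (fun n : ℕ => (⟨HVar.other β n, rfl⟩ : {x : HVar S // x.type = β}))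
    (fun _ _ h => (HVar.other.inj (Subtype.mk.inj h)).2)

/-- An atom as a variable. -/
def vAtom (a : S.Atom) : S.hol.Var (.base (.name a.1)) := ⟨.atom a, rfl⟩

/-- The variable `X_D`. -/
def vUnk (D : List S.Atom) {α : S.Sort'} {P : S.Perms} (X : S.Unk α P) :
    S.hol.Var (arrows (restr D P) (trSort α)) := ⟨.unk ⟨α, P, X⟩ D, rfl⟩

/-- The iterated application `t (π d₁) ⋯ (π dₙ)` of a term to `π · [d₁, …, dₙ]`. -/
def appAtoms (π : AtomPerm S) {β : HOL.Ty (HBase S)} :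
    (L : List S.Atom) → HOL.RTm S.hol (arrows L β) → HOL.RTm S.hol β
  | [], t => t
  | a :: L, t => appAtoms π L (.app t (.var (vAtom (π.act a))))

/-- Translation of raw terms. -/
def RTerm.tr (D : List S.Atom) : {α : S.Sort'} → RTerm S α → HOL.RTm S.hol (trSort α)
  | _, .atom (ν := ν) a => .var (vAtom ⟨ν, a⟩)
  | _, .tuple rs => .tuple fun i => (rs i).tr D
  | _, .app f r => .app (.const (HConst.tf f)) (r.tr D)
  | _, .abs (ν := ν) a r => .lam (vAtom ⟨ν, a⟩) (r.tr D)
  | _, .unk (P := P) π X => appAtoms π (restr D P) (.var (vUnk D X))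

/-- Translation of raw propositions. -/
def RForm.tr (D : List S.Atom) : RForm S → HOL.RTm S.hol S.hol.omega
  | .bot => .const HConst.bot
  | .imp φ ψ => .impl (φ.tr D) (ψ.tr D)
  | .pred P r => .app (.const (HConst.pf P)) (r.tr D)
  | .all X φ => .forAll (vUnk D X) (φ.tr D)

/-! ### The translation respects α-equivalence -/

theorem vAtom_injective {ν : S.Name} :
    @Function.Injective (S.At ν) (S.hol.Var (.base (.name ν))) (fun a => vAtom ⟨ν, a⟩) := by
  intro a b h
  have h' := HVar.atom.inj (Subtype.mk.inj h)
  simpa using h'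

theorem vUnk_injective (D : List S.Atom) {α : S.Sort'} {P : S.Perms} :
    Function.Injective fun X : S.Unk α P => vUnk D X := by
  intro X Y h
  have h' := (HVar.unk.inj (Subtype.mk.inj h)).1
  simpa using h'

theorem underlying_eq {x y : S.hol.Variable} (h : x = y) : x.2.1 = y.2.1 := by rw [h]

theorem varSwap_of_ne {β : S.hol.Typ} {x y : S.hol.Var β} {β' : S.hol.Typ} {z : S.hol.Var β'}
    (hx : z.1 ≠ x.1) (hy : z.1 ≠ y.1) : HOL.varSwap y x β' z = z := by
  have h := HOL.VarPerm.act_varSwap_of_ne (T := S.hol) (x := x) (y := y) (z := ⟨β', z⟩)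
    (fun h => hx (underlying_eq h)) (fun h => hy (underlying_eq h))
  simpa [HOL.VarPerm.act] using h

theorem varSwap_vAtom {ν : S.Name} (a b : S.At ν) (c : S.Atom) :
    HOL.varSwap (vAtom (S := S) ⟨ν, b⟩) (vAtom ⟨ν, a⟩) (.base (.name c.1)) (vAtom c) =
      vAtom ((atomSwap b a).act c) := by
  obtain ⟨ν', c⟩ := c
  by_cases hν : ν' = ν
  · subst hν
    simp only [HOL.varSwap, AtomPerm.act, atomSwap, Pi.mulSingle_eq_same]
    refine (@Function.Injective.swap_apply _ _ (fun a b => propDecidable (a = b))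
      (fun a b => propDecidable (a = b)) _ (vAtom_injective (S := S)) b a c).trans
        (Subtype.ext ?_)
    simp only [vAtom, Pi.mulSingle_eq_same]
  · rw [varSwap_of_ne]
    · have h : (atomSwap b a).1 ν' c = c := by
        simpa [AtomPerm.act] using (AtomPerm.act_atomSwap_of_ne (a := a) (b := b) (c := ⟨ν', c⟩)
          (fun h => hν (congrArg Sigma.fst h)) (fun h => hν (congrArg Sigma.fst h)))
      exact Subtype.ext (congrArg (fun c : S.At ν' => HVar.atom (S := S) ⟨ν', c⟩) h.symm)
    · intro h
      exact hν (congrArg Sigma.fst (HVar.atom.inj h))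
    · intro h
      exact hν (congrArg Sigma.fst (HVar.atom.inj h))

theorem perm_appAtoms (p : HOL.VarPerm S.hol) (π' π : AtomPerm S)
    (h : ∀ c : S.Atom, p _ (vAtom c) = vAtom (π'.act c)) {β : HOL.Ty (HBase S)} (L : List S.Atom)
    (t : HOL.RTm S.hol (arrows L β)) :
    (appAtoms π L t).perm p = appAtoms (π' * π) L (t.perm p) := by
  induction L with
  | nil => rfl
  | cons a L ih =>
    simp only [appAtoms]
    rw [ih]
    simp only [HOL.RTm.perm]
    congr 3
    exact h (π.act a)

theorem RTerm.tr_perm (D : List S.Atom) {ν : S.Name} (a b : S.At ν) {α : S.Sort'}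
    (r : RTerm S α) : (r.perm (atomSwap b a)).tr D =
      (r.tr D).perm (HOL.varSwap (vAtom (S := S) ⟨ν, b⟩) (vAtom ⟨ν, a⟩)) := by
  induction r with
  | atom c => exact (congrArg HOL.RTm.var (varSwap_vAtom a b ⟨_, c⟩)).symm
  | tuple rs ih => exact congrArg HOL.RTm.tuple (funext ih)
  | app f r ih => simp only [RTerm.perm, RTerm.tr, HOL.RTm.perm, ih]
  | abs c r ih => exact congr (congrArg HOL.RTm.lam (varSwap_vAtom a b ⟨_, c⟩).symm) ih
  | unk π X =>
    simp only [RTerm.perm, RTerm.tr]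
    rw [perm_appAtoms _ (atomSwap b a) _ (varSwap_vAtom a b)]
    simp only [HOL.RTm.perm]
    rw [varSwap_of_ne]
    · intro h
      cases h
    · intro h
      cases h

theorem fv_appAtoms (π : AtomPerm S) {β : HOL.Ty (HBase S)} (L : List S.Atom)
    (t : HOL.RTm S.hol (arrows L β)) (z : S.hol.Variable) (hz : z ∈ (appAtoms π L t).fv) :
    z ∈ t.fv ∨ ∃ a ∈ L, z.2.1 = HVar.atom (π.act a) := by
  induction L with
  | nil => exact Or.inl hz
  | cons a L ih =>
    rcases ih _ hz with h | ⟨c, hc, h⟩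
    · simp only [HOL.RTm.fv, Set.mem_union, Set.mem_singleton_iff] at h
      rcases h with h | h
      · exact Or.inl h
      · exact Or.inr ⟨a, by simp, underlying_eq h⟩
    · exact Or.inr ⟨c, List.mem_cons_of_mem _ hc, h⟩

theorem RTerm.fa_of_mem_fv_tr (D : List S.Atom) {α : S.Sort'} (r : RTerm S α)
    (z : S.hol.Variable) (hz : z ∈ (r.tr D).fv) (a : S.Atom) (ha : z.2.1 = HVar.atom a) :
    a ∈ r.fa := by
  induction r with
  | atom c =>
    have h := underlying_eq (Set.mem_singleton_iff.1 hz)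
    rw [ha] at h
    exact HVar.atom.inj h
  | tuple rs ih =>
    obtain ⟨i, hi⟩ := Set.mem_iUnion.1 hz
    exact Set.mem_iUnion.2 ⟨i, ih i hi⟩
  | app f r ih =>
    rcases hz with hz | hz
    · exact hz.elim
    · exact ih hz
  | abs c r ih =>
    refine ⟨ih hz.1, fun h => hz.2 ?_⟩
    obtain rfl := Set.mem_singleton_iff.1 h
    obtain ⟨β, z, rfl⟩ := z
    subst ha
    rfl
  | unk π X =>
    rcases fv_appAtoms π _ _ z hz with h | ⟨c, hc, h⟩
    · have h := underlying_eq (Set.mem_singleton_iff.1 h)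
      rw [ha] at h
      cases h
    · rw [ha] at h
      refine ⟨c, ?_, (HVar.atom.inj h).symm⟩
      simpa using (List.mem_filter.1 hc).2

theorem RTerm.Aeq.tr (D : List S.Atom) {α : S.Sort'} {r s : RTerm S α} (h : r.Aeq s) :
    (r.tr D).Aeq (s.tr D) := by
  induction h with
  | refl r => exact .refl _
  | symm _ ih => exact ih.symm
  | trans _ _ ih ih' => exact ih.trans ih'
  | tuple _ ih => exact .tuple ih
  | app _ ih => exact .app (.refl _) ih
  | abs _ ih => exact .lam ih
  | swap ha hb =>
    rw [RTerm.tr_perm]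
    exact .swap (fun h => ha (RTerm.fa_of_mem_fv_tr D _ _ h _ rfl))
      (fun h => hb (RTerm.fa_of_mem_fv_tr D _ _ h _ rfl))

theorem varSwap_vUnk (D : List S.Atom) {α : S.Sort'} {P : S.Perms} (X Y : S.Unk α P)
    {α' : S.Sort'} {P' : S.Perms} (Z : S.Unk α' P') :
    HOL.varSwap (vUnk D Y) (vUnk D X) _ (vUnk D Z) = vUnk D (unkSwap Y X α' P' Z) := by
  by_cases hα : α' = α
  · subst hα
    by_cases hP : P' = P
    · subst hP
      simp only [HOL.varSwap, unkSwap, Pi.mulSingle_eq_same]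
      exact @Function.Injective.swap_apply _ _ (fun a b => propDecidable (a = b))
        (fun a b => propDecidable (a = b)) _ (vUnk_injective D) Y X Z
    · rw [varSwap_of_ne]
      · simp [unkSwap, Pi.mulSingle_eq_of_ne hP]
      · intro h
        exact hP (congrArg (fun Z : S.Unknown => Z.2.1) (HVar.unk.inj h).1)
      · intro h
        exact hP (congrArg (fun Z : S.Unknown => Z.2.1) (HVar.unk.inj h).1)
  · rw [varSwap_of_ne]
    · simp [unkSwap, Pi.mulSingle_eq_of_ne hα]
    · intro h
      exact hα (congrArg (fun Z : S.Unknown => Z.1) (HVar.unk.inj h).1)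
    · intro h
      exact hα (congrArg (fun Z : S.Unknown => Z.1) (HVar.unk.inj h).1)

theorem varSwap_vUnk_vAtom (D : List S.Atom) {α : S.Sort'} {P : S.Perms} (X Y : S.Unk α P)
    (a : S.Atom) : HOL.varSwap (vUnk D Y) (vUnk D X) _ (vAtom a) = vAtom a := by
  refine varSwap_of_ne ?_ ?_
  · intro h
    cases h
  · intro h
    cases h

theorem RTerm.tr_permU (D : List S.Atom) {α : S.Sort'} {P : S.Perms} (X Y : S.Unk α P)
    {α' : S.Sort'} (r : RTerm S α') :
    (r.permU (unkSwap Y X)).tr D = (r.tr D).perm (HOL.varSwap (vUnk D Y) (vUnk D X)) := by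
  induction r with
  | atom c => exact (congrArg HOL.RTm.var (varSwap_vUnk_vAtom D X Y ⟨_, c⟩)).symm
  | tuple rs ih => exact congrArg HOL.RTm.tuple (funext ih)
  | app f r ih => simp only [RTerm.permU, RTerm.tr, HOL.RTm.perm, ih]
  | abs c r ih => exact congr (congrArg HOL.RTm.lam (varSwap_vUnk_vAtom D X Y ⟨_, c⟩).symm) ih
  | unk π Z =>
    simp only [RTerm.permU, RTerm.tr]
    rw [perm_appAtoms _ 1 _ (varSwap_vUnk_vAtom D X Y), one_mul]
    simp only [HOL.RTm.perm]
    rw [varSwap_vUnk]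

theorem RForm.tr_permU (D : List S.Atom) {α : S.Sort'} {P : S.Perms} (X Y : S.Unk α P)
    (φ : RForm S) :
    (φ.permU (unkSwap Y X)).tr D = (φ.tr D).perm (HOL.varSwap (vUnk D Y) (vUnk D X)) := by
  induction φ with
  | bot => rfl
  | imp φ ψ ih ih' =>
    simp only [RForm.permU, RForm.tr, HOL.RTm.impl, HOL.RTm.perm, ih, ih']
  | pred Q r => simp only [RForm.permU, RForm.tr, HOL.RTm.perm, RTerm.tr_permU]
  | all Z φ ih =>
    exact congrArg (HOL.RTm.app _) (congr (congrArg HOL.RTm.lam (varSwap_vUnk D X Y Z).symm) ih)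

theorem RTerm.fU_of_mem_fv_tr (D : List S.Atom) {α : S.Sort'} (r : RTerm S α)
    (z : S.hol.Variable) (hz : z ∈ (r.tr D).fv) (X : S.Unknown) (hX : z.2.1 = HVar.unk X D) :
    X ∈ r.fU := by
  induction r with
  | atom c =>
    have h := underlying_eq (Set.mem_singleton_iff.1 hz)
    rw [hX] at h
    cases h
  | tuple rs ih =>
    obtain ⟨i, hi⟩ := Set.mem_iUnion.1 hz
    exact Set.mem_iUnion.2 ⟨i, ih i hi⟩
  | app f r ih =>
    rcases hz with hz | hz
    · exact hz.elim
    · exact ih hz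
  | abs c r ih => exact ih hz.1
  | unk π Y =>
    rcases fv_appAtoms π _ _ z hz with h | ⟨c, hc, h⟩
    · have h := underlying_eq (Set.mem_singleton_iff.1 h)
      rw [hX] at h
      exact (HVar.unk.inj h).1
    · rw [hX] at h
      cases h

theorem RForm.fU_of_mem_fv_tr (D : List S.Atom) (φ : RForm S)
    (z : S.hol.Variable) (hz : z ∈ (φ.tr D).fv) (X : S.Unknown) (hX : z.2.1 = HVar.unk X D) :
    X ∈ φ.fU := by
  induction φ with
  | bot => exact hz.elim
  | imp φ ψ ih ih' =>
    rcases hz with (hz | hz) | hz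
    · exact hz.elim
    · exact Or.inl (ih hz)
    · exact Or.inr (ih' hz)
  | pred Q r =>
    rcases hz with hz | hz
    · exact hz.elim
    · exact RTerm.fU_of_mem_fv_tr D r z hz X hX
  | all Y φ ih =>
    rcases hz with hz | hz
    · exact hz.elim
    · refine ⟨ih hz.1, fun h => hz.2 ?_⟩
      obtain rfl := Set.mem_singleton_iff.1 h
      obtain ⟨β, z, rfl⟩ := z
      subst hX
      rfl

theorem RForm.Aeq.tr (D : List S.Atom) {φ ψ : RForm S} (h : φ.Aeq ψ) :
    (φ.tr D).Aeq (ψ.tr D) := by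
  induction h with
  | refl r => exact .refl _
  | symm _ ih => exact ih.symm
  | trans _ _ ih ih' => exact ih.trans ih'
  | imp _ _ ih ih' => exact .app (.app (.refl _) ih) ih'
  | pred h => exact .app (.refl _) (h.tr D)
  | all _ ih => exact .app (.refl _) (.lam ih)
  | swap hX hY =>
    rw [RForm.tr_permU]
    exact .swap (fun h => hX (RForm.fU_of_mem_fv_tr D _ _ h _ rfl))
      (fun h => hY (RForm.fU_of_mem_fv_tr D _ _ h _ rfl))

/-- Translation of propositions. -/
def Form.tr (D : List S.Atom) : Form S → HOL.Form S.hol :=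
  Quotient.map (RForm.tr D) fun _ _ h => RForm.Aeq.tr D h

end PNL
end

/-! ### Renaming and β-redexes in higher-order logic -/

namespace HOL

variable {T : Signature.{u}}

/-! Every rule except left `∀` translates directly to its HOL counterpart: the translation commutes
with the connectives, and `X_D` is free in a translated proposition only if `X` is free in the
original, so eigenvariable conditions carry over. For left `∀` the HOL instance is `λ d₁ ⋯ dₙ. ⟦r⟧`,
where the `dᵢ` list `D ∩ pmss(X)`. What has to be shown is that `(λ X_D. ⟦φ⟧) (λ d₁ ⋯ dₙ. ⟦r⟧)` is
αβ-equivalent to `⟦φ[X := r]⟧`.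

Capture typing enters this comparison at two places. At `π · X` the redex becomes `(λ d₁ ⋯ dₙ. ⟦r⟧)
(π d₁) ⋯ (π dₙ)`, which should be `⟦π · r⟧`. This holds because `D` contains every atom of `pmss(X)`
moved by `π`, so `π` fixes all free variables of the abstraction (`appAtoms_lams_tr`). At `[a]s` the
PNL substitution may capture `a` whereas the HOL one may not. If `X` occurs in `s`, capture typing
puts `a` in `D` unless `a ∉ pmss(X)`, so `a` is not free in `λ d₁ ⋯ dₙ. ⟦r⟧` and there is nothing to
capture. If `X` does not occur, both sides are unchanged by the substitution. These facts combine in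
`RTerm.redex_tr_abeq_tr_subst` and `RForm.redex_tr_abeq_tr_subst`.

Raw HOL substitution makes sense only on suitable representatives, so the comparison is made with
β-redexes, which are pushed through the term constructors up to αβ-equivalence (`redex_app`,
`redex_tuple`, `redex_lam`).

For the existence of `D`, a derivation with finite conclusion contains finitely many sequents, all
finite. Each proposition is capture-typed by every list that contains a certain finite set of atoms,
so the union of these sets, listed without repetition, serves. -/

theorem RTm.perm_perm (p q : VarPerm T) {β : T.Typ} (t : RTm T β) :
    (t.perm q).perm p = t.perm (p * q) := by
  induction t with
  | var x => rfl
  | lam x t ih => simp only [RTm.perm, ih]; rfl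
  | app t' t ih' ih => simp only [RTm.perm, ih, ih']
  | tuple ts ih => simp only [RTm.perm, ih]
  | const g => rfl

theorem RTm.fv_finite {β : T.Typ} (t : RTm T β) : t.fv.Finite := by
  induction t with
  | var x => exact Set.finite_singleton _
  | lam x t ih => exact ih.sdiff
  | app t' t ih' ih => exact ih'.union ih
  | tuple ts ih => exact Set.finite_iUnion ih
  | const g => exact Set.finite_empty

theorem exists_fresh (β : T.Typ) {V : Set T.Variable} (hV : V.Finite) :
    ∃ z : T.Var β, (⟨β, z⟩ : T.Variable) ∉ V := by
  have := T.var_infinite β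
  exact (hV.preimage (f := Sigma.mk β) sigma_mk_injective.injOn).exists_notMem

@[simp]
theorem varSwap_apply_right {β : T.Typ} (x z : T.Var β) : varSwap z x β x = z := by
  simp [varSwap]

theorem VarPerm.act_mul (p q : VarPerm T) (z : T.Variable) : (p * q).act z = p.act (q.act z) := rfl

theorem VarPerm.act_varSwap_right {β : T.Typ} (x z : T.Var β) :
    VarPerm.act (varSwap z x) ⟨β, x⟩ = ⟨β, z⟩ := by
  simp [VarPerm.act]

/-! ### Renaming -/

theorem RTm.lam_aeq_rename {β' β : T.Typ} (x z : T.Var β') (t : RTm T β)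
    (hz : (⟨β', z⟩ : T.Variable) ∉ t.fv) :
    (RTm.lam x t).Aeq (.lam z (t.perm (varSwap z x))) := by
  have h : ((RTm.lam x t).perm (varSwap z x)).Aeq (.lam x t) :=
    .swap (fun h => h.2 rfl) (fun h => hz h.1)
  simp only [RTm.perm, varSwap_apply_right] at h
  exact h.symm

/-- Permutations that agree on the free variables of a term act on it in the same way. -/
theorem RTm.perm_aeq_perm {β : T.Typ} (t : RTm T β) (p q : VarPerm T)
    (h : ∀ z ∈ t.fv, p.act z = q.act z) : (t.perm p).Aeq (t.perm q) := by
  induction t generalizing p q with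
  | @var β x =>
    have hx : p β x = q β x := by simpa [VarPerm.act] using h ⟨β, x⟩ rfl
    simp only [RTm.perm, hx]
    exact .refl _
  | @lam β' β x t ih =>
    -- Both binders are renamed to one fresh `z`. The bodies are then images of `t` under two
    -- composite permutations that agree on `x` too, since both send it to `z`, and the induction
    -- hypothesis applies.
    obtain ⟨z, hz⟩ := exists_fresh β' ((t.perm p).fv_finite.union (t.perm q).fv_finite)
    simp only [Set.mem_union, not_or] at hz
    refine (lam_aeq_rename (p β' x) z _ hz.1).trans
      (.trans (.lam ?_) (lam_aeq_rename (q β' x) z _ hz.2).symm)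
    rw [perm_perm, perm_perm]
    refine ih _ _ fun w hw => ?_
    simp only [VarPerm.act_mul]
    by_cases hwx : w = ⟨β', x⟩
    · subst hwx
      exact (VarPerm.act_varSwap_right (p β' x) z).trans
        (VarPerm.act_varSwap_right (q β' x) z).symm
    · have hpq := h w ⟨hw, hwx⟩
      rw [VarPerm.act_varSwap_of_ne, VarPerm.act_varSwap_of_ne, hpq]
      · exact fun h => hwx (q.act_injective h)
      · exact fun h => hz.2 (h ▸ fv_perm q t ▸ Set.mem_image_of_mem _ hw)
      · exact fun h => hwx (p.act_injective h)
      · exact fun h => hz.1 (h ▸ fv_perm p t ▸ Set.mem_image_of_mem _ hw)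
  | app t' t ih' ih =>
    exact .app (ih' _ _ fun z hz => h z (Or.inl hz)) (ih _ _ fun z hz => h z (Or.inr hz))
  | tuple ts ih =>
    exact .tuple fun i => ih i _ _ fun z hz => h z (Set.mem_iUnion.2 ⟨i, hz⟩)
  | const g => exact .refl _

theorem RTm.perm_one {β : T.Typ} (t : RTm T β) : t.perm 1 = t := by
  induction t with
  | var x => rfl
  | lam x t ih => simp only [RTm.perm, ih]; rfl
  | app t' t ih' ih => simp only [RTm.perm, ih, ih']
  | tuple ts ih => simp only [RTm.perm, ih]
  | const g => rfl

theorem RTm.perm_aeq_self {β : T.Typ} (t : RTm T β) (p : VarPerm T)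
    (h : ∀ z ∈ t.fv, p.act z = z) : (t.perm p).Aeq t := by
  simpa only [perm_one] using t.perm_aeq_perm p 1 h

theorem RTm.Aeq.perm {β : T.Typ} {t u : RTm T β} (h : t.Aeq u) (p : VarPerm T) :
    (t.perm p).Aeq (u.perm p) := by
  induction h with
  | refl t => exact .refl _
  | symm _ ih => exact ih.symm
  | trans _ _ ih ih' => exact ih.trans ih'
  | lam _ ih => exact .lam ih
  | app _ _ ih' ih => exact .app ih' ih
  | tuple _ ih => exact .tuple ih
  | swap hx hy =>
    -- Composing with the swap changes nothing on the free variables of the term, since neither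
    -- swapped variable is free in it.
    rw [RTm.perm_perm]
    refine RTm.perm_aeq_perm _ _ _ fun z hz => ?_
    rw [VarPerm.act_mul, VarPerm.act_varSwap_of_ne (fun h => hx (h ▸ hz)) (fun h => hy (h ▸ hz))]

/-! ### Representatives with fresh bound variables -/

theorem RTm.BoundAvoids.mono {V W : Set T.Variable} (h : V ⊆ W) {β : T.Typ} {t : RTm T β}
    (ht : t.BoundAvoids W) : t.BoundAvoids V := by
  induction t with
  | var x => trivial
  | lam x t ih => exact ⟨fun hx => ht.1 (h hx), ih ht.2⟩
  | app t' t ih' ih => exact ⟨ih' ht.1, ih ht.2⟩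
  | tuple ts ih => exact fun i => ih i (ht i)
  | const g => trivial

theorem RTm.BoundAvoids.perm {V : Set T.Variable} {p : VarPerm T} {β : T.Typ} {t : RTm T β}
    (ht : t.BoundAvoids (p.act ⁻¹' V)) : (t.perm p).BoundAvoids V := by
  induction t with
  | var x => trivial
  | lam x t ih => exact ⟨ht.1, ih ht.2⟩
  | app t' t ih' ih => exact ⟨ih' ht.1, ih ht.2⟩
  | tuple ts ih => exact fun i => ih i (ht i)
  | const g => trivial

theorem RTm.exists_aeq_boundAvoids {β : T.Typ} (t : RTm T β) {V : Set T.Variable}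
    (hV : V.Finite) : ∃ t' : RTm T β, t.Aeq t' ∧ t'.BoundAvoids V := by
  induction t generalizing V with
  | var x => exact ⟨_, .refl _, trivial⟩
  | @lam β' β x t ih =>
    obtain ⟨z, hz⟩ := exists_fresh β' (hV.union t.fv_finite)
    simp only [Set.mem_union, not_or] at hz
    -- The body must avoid `x` and `z` besides `V`: the swap fixes all other variables, so after it
    -- the binders still avoid `V`.
    obtain ⟨t', h, h'⟩ := ih ((hV.insert ⟨β', z⟩).insert ⟨β', x⟩)
    refine ⟨.lam z (t'.perm (varSwap z x)),
      (Aeq.lam h).trans (lam_aeq_rename x z t' (h.fv_eq ▸ hz.2)), hz.1, BoundAvoids.perm ?_⟩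
    refine h'.mono fun w hw => ?_
    by_cases hx : w = ⟨β', x⟩
    · exact Or.inl hx
    by_cases hwz : w = ⟨β', z⟩
    · exact Or.inr (Or.inl hwz)
    rw [Set.mem_preimage, VarPerm.act_varSwap_of_ne hx hwz] at hw
    exact Or.inr (Or.inr hw)
  | app t' t ih' ih =>
    obtain ⟨s', h1, h2⟩ := ih' hV
    obtain ⟨s, h3, h4⟩ := ih hV
    exact ⟨.app s' s, .app h1 h3, h2, h4⟩
  | tuple ts ih =>
    choose ss h h' using fun i => ih i hV
    exact ⟨.tuple ss, .tuple h, h'⟩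
  | const g => exact ⟨_, .refl _, trivial⟩

theorem RTm.exists_aeq_canSubst {β' β : T.Typ} (t : RTm T β) (x : T.Var β') (u : RTm T β') :
    ∃ t' : RTm T β, t.Aeq t' ∧ t'.CanSubst x u :=
  t.exists_aeq_boundAvoids (u.fv_finite.insert _)

/-! ### Substitution by way of β-redexes -/

theorem RTm.subst_var_self {β' : T.Typ} (x : T.Var β') (u : RTm T β') :
    RTm.subst x u (.var x) = u := by
  simp [RTm.subst]

theorem RTm.subst_of_notMem_fv {β' : T.Typ} (x : T.Var β') (u : RTm T β') {β : T.Typ}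
    (t : RTm T β) (ht : t.CanSubst x u) (hx : (⟨β', x⟩ : T.Variable) ∉ t.fv) :
    RTm.subst x u t = t := by
  classical
  induction t with
  | @var β y =>
    rw [RTm.subst, Function.update_of_ne]
    exact fun h => hx h.symm
  | lam y t ih =>
    -- Raw substitution also replaces occurrences bound by `x` itself; `CanSubst` excludes such
    -- binders.
    rw [RTm.subst, ih ht.2 fun h => hx ⟨h, fun h' => ht.1 (Or.inl h'.symm)⟩]
  | app t' t ih' ih =>
    rw [RTm.subst, ih' ht.1 fun h => hx (Or.inl h), ih ht.2 fun h => hx (Or.inr h)]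
  | tuple ts ih =>
    rw [RTm.subst, funext fun i => ih i (ht i) fun h => hx (Set.mem_iUnion.2 ⟨i, h⟩)]
  | const g => rfl

theorem RTm.subst_self {β' : T.Typ} (x : T.Var β') {β : T.Typ} (t : RTm T β) :
    RTm.subst x (.var x) t = t := by
  classical
  induction t with
  | @var β y =>
    rw [RTm.subst]
    by_cases h : (⟨β, y⟩ : T.Variable) = ⟨β', x⟩
    · obtain ⟨rfl, h⟩ := Sigma.mk.inj h
      obtain rfl := eq_of_heq h
      simp
    · rw [Function.update_of_ne h]
  | lam y t ih => rw [RTm.subst, ih]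
  | app t' t ih' ih => rw [RTm.subst, ih', ih]
  | tuple ts ih => rw [RTm.subst, funext ih]
  | const g => rfl

/-- A redex is meaningful for any raw body, while substitution needs a good representative. This is
the passage between the two, and the redex lemmas below all go through it. -/
theorem RTm.redex_abeq_subst {β' β : T.Typ} {x : T.Var β'} {u : RTm T β'} {t t' : RTm T β}
    (h : t.Aeq t') (h' : t'.CanSubst x u) : (RTm.app (.lam x t) u).ABeq (RTm.subst x u t') :=
  .trans (.app (.lam (.alpha h)) (.alpha (.refl _))) (.beta x u t' h')

theorem RTm.redex_var_self {β' : T.Typ} (x : T.Var β') (u : RTm T β') :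
    (RTm.app (.lam x (.var x)) u).ABeq u := by
  simpa only [subst_var_self] using ABeq.beta x u (.var x) trivial

theorem RTm.redex_of_notMem_fv {β' β : T.Typ} {x : T.Var β'} (u : RTm T β') {t : RTm T β}
    (hx : (⟨β', x⟩ : T.Variable) ∉ t.fv) : (RTm.app (.lam x t) u).ABeq t := by
  obtain ⟨t', h, h'⟩ := t.exists_aeq_canSubst x u
  have := redex_abeq_subst h h'
  rw [subst_of_notMem_fv x u t' h' (h.fv_eq ▸ hx)] at this
  exact this.trans (.alpha h.symm)

/-- Used once bound atoms have been renamed to the arguments they receive: each β-step then merely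
strips a binder. -/
theorem RTm.redex_self {β' β : T.Typ} (x : T.Var β') (t : RTm T β) :
    (RTm.app (.lam x t) (.var x)).ABeq t := by
  obtain ⟨t', h, h'⟩ := t.exists_aeq_canSubst x (.var x)
  have := redex_abeq_subst h h'
  rw [subst_self] at this
  exact this.trans (.alpha h.symm)

theorem RTm.redex_app {γ β' β : T.Typ} (x : T.Var γ) (u : RTm T γ)
    (s : RTm T (.arrow β' β)) (t : RTm T β') :
    (RTm.app (.lam x (.app s t)) u).ABeq (.app (.app (.lam x s) u) (.app (.lam x t) u)) := by
  obtain ⟨s', h1, h2⟩ := s.exists_aeq_canSubst x u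
  obtain ⟨t', h3, h4⟩ := t.exists_aeq_canSubst x u
  exact .trans (redex_abeq_subst (.app h1 h3) ⟨h2, h4⟩)
    (.app (redex_abeq_subst h1 h2).symm (redex_abeq_subst h3 h4).symm)

theorem RTm.redex_tuple {γ : T.Typ} (x : T.Var γ) (u : RTm T γ) {n : ℕ} {βs : Fin n → T.Typ}
    (ts : ∀ i, RTm T (βs i)) :
    (RTm.app (.lam x (.tuple ts)) u).ABeq (.tuple fun i => .app (.lam x (ts i)) u) := by
  choose ss h h' using fun i => (ts i).exists_aeq_canSubst x u
  exact .trans (redex_abeq_subst (.tuple h) h')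
    (.tuple fun i => (redex_abeq_subst (h i) (h' i)).symm)

/-- The only redex rule with a capture condition; `hu` is what capture typing supplies for atom
binders, and the condition on bound unknowns for quantifiers. -/
theorem RTm.redex_lam {γ β' β : T.Typ} {x : T.Var γ} {u : RTm T γ} {y : T.Var β'}
    (t : RTm T β) (hx : (⟨β', y⟩ : T.Variable) ≠ ⟨γ, x⟩) (hu : (⟨β', y⟩ : T.Variable) ∉ u.fv) :
    (RTm.app (.lam x (.lam y t)) u).ABeq (.lam y (.app (.lam x t) u)) := by
  obtain ⟨t', h, h'⟩ := t.exists_aeq_canSubst x u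
  exact .trans (redex_abeq_subst (.lam h) ⟨fun h => h.elim hx hu, h'⟩)
    (.lam (redex_abeq_subst h h').symm)

end HOL

/-! ### The translation of substitution, soundness, and capture-typing lists -/

namespace PNL

variable {S : Signature.{u}}

/-! ### Permutations of atoms as permutations of variables -/

/-- The action of a permutation of atoms on the variables of the translated signature. -/
def HVar.perm (π : AtomPerm S) : HVar S → HVar S
  | .atom a => .atom (π.act a)
  | .unk X D => .unk X D
  | .other β n => .other β n

theorem HVar.type_perm (π : AtomPerm S) (x : HVar S) : (x.perm π).type = x.type := by
  cases x <;> rfl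

theorem HVar.perm_perm_of_mul_eq_one {π π' : AtomPerm S} (h : π * π' = 1) (x : HVar S) :
    (x.perm π').perm π = x := by
  cases x with
  | atom a =>
    simp only [HVar.perm, ← AtomPerm.act_mul, h]
    rfl
  | unk X D => rfl
  | other β n => rfl

/-- The permutation of variables induced by a permutation of atoms. -/
def atomVarPerm (π : AtomPerm S) : HOL.VarPerm S.hol := fun _ =>
  { toFun := fun x => ⟨x.1.perm π, (x.1.type_perm π).trans x.2⟩
    invFun := fun x => ⟨x.1.perm π⁻¹, (x.1.type_perm π⁻¹).trans x.2⟩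
    left_inv := fun x => Subtype.ext (x.1.perm_perm_of_mul_eq_one (inv_mul_cancel π))
    right_inv := fun x => Subtype.ext (x.1.perm_perm_of_mul_eq_one (mul_inv_cancel π)) }

theorem atomVarPerm_vAtom (π : AtomPerm S) (a : S.Atom) :
    atomVarPerm π _ (vAtom a) = vAtom (π.act a) := rfl

/-- This is an equality of raw terms: the variables `X_D` stay fixed, and moving the arguments `π'
dᵢ` by `π` gives those of `π * π'`. -/
theorem RTerm.tr_perm_eq (D : List S.Atom) (π : AtomPerm S) {α : S.Sort'} (r : RTerm S α) :
    (r.perm π).tr D = (r.tr D).perm (atomVarPerm π) := by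
  induction r with
  | atom c => rfl
  | tuple rs ih => exact congrArg HOL.RTm.tuple (funext ih)
  | app f r ih => simp only [RTerm.perm, RTerm.tr, HOL.RTm.perm, ih]
  | abs c r ih => exact congrArg (HOL.RTm.lam (vAtom ⟨_, π.1 _ c⟩)) ih
  | unk π' X =>
    simp only [RTerm.perm, RTerm.tr]
    rw [perm_appAtoms _ π π' (atomVarPerm_vAtom π)]
    rfl

theorem eq_vAtom_of_val_eq {z : S.hol.Variable} {a : S.Atom} (h : z.2.1 = HVar.atom a) :
    z = ⟨_, vAtom a⟩ := by
  obtain ⟨β, z, rfl⟩ := z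
  subst h
  rfl

/-! ### Iterated abstraction and application -/

/-- The iterated abstraction `λ d₁ ⋯ dₙ. t`. -/
def lams {β : HOL.Ty (HBase S)} :
    (L : List S.Atom) → HOL.RTm S.hol β → HOL.RTm S.hol (arrows L β)
  | [], t => t
  | a :: L, t => .lam (vAtom a) (lams L t)

theorem mem_fv_lams {β : HOL.Ty (HBase S)} (L : List S.Atom) (t : HOL.RTm S.hol β)
    (z : S.hol.Variable) :
    z ∈ (lams L t).fv ↔ z ∈ t.fv ∧ ∀ a ∈ L, z ≠ ⟨_, vAtom a⟩ := by
  induction L with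
  | nil => exact ⟨fun h => ⟨h, by simp⟩, fun h => h.1⟩
  | cons a L ih =>
    have h : z ∈ (lams (a :: L) t).fv ↔ z ∈ (lams L t).fv ∧ z ≠ ⟨_, vAtom a⟩ := Iff.rfl
    rw [h, ih, List.forall_mem_cons, and_assoc, and_comm (a := z ≠ _)]

theorem appAtoms_abeq (π : AtomPerm S) {β : HOL.Ty (HBase S)} (L : List S.Atom)
    {t u : HOL.RTm S.hol (arrows L β)} (h : t.ABeq u) :
    (appAtoms π L t).ABeq (appAtoms π L u) := by
  induction L with
  | nil => exact h
  | cons a L ih => exact ih (.app h (.alpha (.refl _)))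

/-- The renamed binders are literally `π d₁, …, π dₙ`, the same variables as the arguments, so
`redex_self` removes them one at a time. -/
theorem appAtoms_lams_perm (π : AtomPerm S) {β : HOL.Ty (HBase S)} (L : List S.Atom)
    (t : HOL.RTm S.hol β) :
    (appAtoms π L ((lams L t).perm (atomVarPerm π))).ABeq (t.perm (atomVarPerm π)) := by
  induction L with
  | nil => exact .alpha (.refl _)
  | cons a L ih =>
    exact .trans (appAtoms_abeq π L
      (HOL.RTm.redex_self (vAtom (π.act a)) ((lams L t).perm (atomVarPerm π)))) ih

/-- The arguments are atoms, in which `x` cannot occur, so only the head keeps the redex. -/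
theorem redex_appAtoms (π : AtomPerm S) {γ β : HOL.Ty (HBase S)} (x : S.hol.Var γ)
    (u : HOL.RTm S.hol γ) (hx : ∀ a : S.Atom, x.1 ≠ HVar.atom a) (L : List S.Atom)
    (t : HOL.RTm S.hol (arrows L β)) :
    (HOL.RTm.app (.lam x (appAtoms π L t)) u).ABeq (appAtoms π L (.app (.lam x t) u)) := by
  induction L with
  | nil => exact .alpha (.refl _)
  | cons a L ih =>
    refine .trans (ih _) (appAtoms_abeq π L (.trans (HOL.RTm.redex_app x u _ _)
      (.app (.alpha (.refl _)) (HOL.RTm.redex_of_notMem_fv u fun h => ?_))))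
    exact hx _ (underlying_eq (Set.mem_singleton_iff.1 h))

/-- An atom free in the abstraction lies in `r.fa ⊆ P` but not in `restr D P`, hence not in `D`, and
`hπ` says that `π` fixes it. So the abstraction is α-equivalent to its image under `π`, which
`appAtoms_lams_perm` reduces. -/
theorem appAtoms_lams_tr (D : List S.Atom) (π : AtomPerm S) (P : S.Perms) {α : S.Sort'}
    (r : RTerm S α) (hr : r.fa ⊆ P.1) (hπ : ∀ a ∈ π.nontriv ∩ P.1, a ∈ D) :
    (appAtoms π (restr D P) (lams (restr D P) (r.tr D))).ABeq ((r.perm π).tr D) := by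
  rw [RTerm.tr_perm_eq]
  refine .trans (appAtoms_abeq π _ (.alpha (HOL.RTm.perm_aeq_self _ (atomVarPerm π) ?_).symm))
    (appAtoms_lams_perm π _ _)
  intro z hz
  obtain ⟨hz, hL⟩ := (mem_fv_lams _ _ _).1 hz
  obtain ⟨β, ⟨x, rfl⟩⟩ := z
  cases x with
  | atom a =>
    have haP := hr (RTerm.fa_of_mem_fv_tr D r _ hz a rfl)
    have ha : π.act a = a := by
      by_contra hne
      exact hL a (List.mem_filter.2 ⟨hπ a ⟨hne, haP⟩, by simpa using haP⟩) rfl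
    exact eq_vAtom_of_val_eq (congrArg HVar.atom ha)
  | unk X D => rfl
  | other β n => rfl

/-! ### Substitution -/

theorem Subst.single_self {α : S.Sort'} {P : S.Perms} (X : S.Unk α P) (r : RTerm S α)
    (hr : r.fa ⊆ P.1) : (Subst.single X r hr).toFun ⟨α, P, X⟩ = r := by
  simp [Subst.single]

theorem Subst.single_of_ne {α : S.Sort'} {P : S.Perms} (X : S.Unk α P) (r : RTerm S α)
    (hr : r.fa ⊆ P.1) {Y : S.Unknown} (h : Y ≠ ⟨α, P, X⟩) :
    (Subst.single X r hr).toFun Y = .unk 1 Y.2.2 := by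
  simp [Subst.single, h]

theorem RTerm.subst_single_of_notMem_fU {α : S.Sort'} {P : S.Perms} (X : S.Unk α P)
    (r : RTerm S α) (hr : r.fa ⊆ P.1) {α' : S.Sort'} (s : RTerm S α')
    (h : (⟨α, P, X⟩ : S.Unknown) ∉ s.fU) : s.subst (.single X r hr) = s := by
  induction s with
  | atom a => rfl
  | tuple rs ih =>
    rw [RTerm.subst, funext fun i => ih i fun h' => h (Set.mem_iUnion.2 ⟨i, h'⟩)]
  | app f s ih => rw [RTerm.subst, ih h]
  | abs a s ih => rw [RTerm.subst, ih h]
  | unk π Y =>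
    rw [RTerm.subst, Subst.single_of_ne X r hr fun h' => h h'.symm, RTerm.perm, mul_one]

/-- Descending through the term only enlarges `A`, so the atom is still there at an occurrence of
`X`, where the clause for unknowns applies. -/
theorem RTerm.Capt.mem_of_mem_fU {D : List S.Atom} {α : S.Sort'} {P : S.Perms} {X : S.Unk α P}
    {α' : S.Sort'} {s : RTerm S α'} {A : Set S.Atom} (hs : s.Capt D A)
    (hX : (⟨α, P, X⟩ : S.Unknown) ∈ s.fU) {a : S.Atom} (ha : a ∈ A) (haP : a ∈ P.1) : a ∈ D := by
  induction s generalizing A with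
  | atom b => exact hX.elim
  | tuple rs ih =>
    obtain ⟨i, hi⟩ := Set.mem_iUnion.1 hX
    exact ih i (hs i) hi ha
  | app f s ih => exact ih hs hX ha
  | abs b s ih => exact ih hs hX (Set.mem_insert_of_mem _ ha)
  | unk π Y =>
    cases Set.mem_singleton_iff.1 hX
    exact hs a ⟨Or.inr ha, haP⟩

/-- Substitution for an unknown is translated to substitution for the corresponding variable. -/
theorem RTerm.redex_tr_abeq_tr_subst (D : List S.Atom) {α : S.Sort'} {P : S.Perms}
    (X : S.Unk α P) (r : RTerm S α) (hr : r.fa ⊆ P.1) {α' : S.Sort'} (s : RTerm S α')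
    (A : Set S.Atom) (hs : s.Capt D A) :
    (HOL.RTm.app (.lam (vUnk D X) (s.tr D)) (lams (restr D P) (r.tr D))).ABeq
      ((s.subst (.single X r hr)).tr D) := by
  induction s generalizing A with
  | atom a =>
    refine HOL.RTm.redex_of_notMem_fv _ fun h => ?_
    cases underlying_eq (Set.mem_singleton_iff.1 h)
  | tuple rs ih =>
    exact .trans (HOL.RTm.redex_tuple _ _ _) (.tuple fun i => ih i A (hs i))
  | app f s ih =>
    exact .trans (HOL.RTm.redex_app _ _ _ _)
      (.app (HOL.RTm.redex_of_notMem_fv _ fun h => h.elim) (ih A hs))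
  | @abs ν a α' s ih =>
    -- Capture typing constrains `a` relative to `P` only through an occurrence of `X`; without one,
    -- substitution and redex both leave the abstraction unchanged.
    by_cases hX : (⟨α, P, X⟩ : S.Unknown) ∈ s.fU
    · refine .trans (HOL.RTm.redex_lam _ ?_ fun h => ?_) (.lam (ih _ hs))
      · intro h
        cases underlying_eq h
      · obtain ⟨h, h'⟩ := (mem_fv_lams _ _ _).1 h
        have haP := hr (RTerm.fa_of_mem_fv_tr D r _ h ⟨ν, a⟩ rfl)
        refine h' ⟨ν, a⟩ (List.mem_filter.2 ⟨?_, by simpa using haP⟩) rfl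
        exact RTerm.Capt.mem_of_mem_fU (s := s) hs hX (Set.mem_insert _ _) haP
    · rw [RTerm.subst_single_of_notMem_fU X r hr (.abs a s) hX]
      exact HOL.RTm.redex_of_notMem_fv _ fun h =>
        hX (RTerm.fU_of_mem_fv_tr D (.abs a s) _ h _ rfl)
  | @unk π α' P' Y =>
    by_cases hY : (⟨α', P', Y⟩ : S.Unknown) = ⟨α, P, X⟩
    · cases hY
      rw [RTerm.subst, Subst.single_self]
      refine .trans (redex_appAtoms π _ _ ?_ _ _) (.trans (appAtoms_abeq π _
        (HOL.RTm.redex_var_self _ _)) (appAtoms_lams_tr D π P r hr fun a ha => ?_))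
      · intro a h
        cases h
      · exact hs a ⟨Or.inl ha.1, ha.2⟩
    · rw [RTerm.subst_single_of_notMem_fU X r hr (.unk π Y) fun h => hY h.symm]
      exact HOL.RTm.redex_of_notMem_fv _ fun h =>
        hY (RTerm.fU_of_mem_fv_tr D (.unk π Y) _ h _ rfl).symm

/-- Needed for a degenerate case: when `r` is α-equivalent to `X`, the unknown `X` is not in the
substitution's `nontriv`, so a quantifier over `X` itself is allowed. -/
theorem RTerm.tr_subst_single_aeq (D : List S.Atom) {α : S.Sort'} {P : S.Perms}
    (X : S.Unk α P) (r : RTerm S α) (hr : r.fa ⊆ P.1) (h : r.Aeq (.unk 1 X)) {α' : S.Sort'}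
    (s : RTerm S α') : ((s.subst (.single X r hr)).tr D).Aeq (s.tr D) := by
  induction s with
  | atom a => exact .refl _
  | tuple rs ih => exact .tuple ih
  | app f s ih => exact .app (.refl _) ih
  | abs a s ih => exact .lam ih
  | @unk π α' P' Y =>
    by_cases hY : (⟨α', P', Y⟩ : S.Unknown) = ⟨α, P, X⟩
    · cases hY
      have h' := (h.tr D).perm (atomVarPerm π)
      rw [← RTerm.tr_perm_eq, ← RTerm.tr_perm_eq, RTerm.perm, mul_one] at h'
      rwa [RTerm.subst, Subst.single_self]
    · rw [RTerm.subst_single_of_notMem_fU X r hr (.unk π Y) fun h => hY h.symm]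
      exact .refl _

theorem RForm.tr_subst_single_aeq (D : List S.Atom) {α : S.Sort'} {P : S.Perms}
    (X : S.Unk α P) (r : RTerm S α) (hr : r.fa ⊆ P.1) (h : r.Aeq (.unk 1 X)) (φ : RForm S) :
    ((φ.subst (.single X r hr)).tr D).Aeq (φ.tr D) := by
  induction φ with
  | bot => exact .refl _
  | imp φ ψ ih ih' => exact .app (.app (.refl _) ih) ih'
  | pred Q s => exact .app (.refl _) (RTerm.tr_subst_single_aeq D X r hr h s)
  | all Y φ ih => exact .app (.refl _) (.lam ih)

theorem RForm.redex_tr_abeq_tr_subst (D : List S.Atom) {α : S.Sort'} {P : S.Perms}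
    (X : S.Unk α P) (r : RTerm S α) (hr : r.fa ⊆ P.1) (φ : RForm S) (A : Set S.Atom)
    (hφ : φ.Capt D A) (hb : φ.BoundAvoids (Subst.single X r hr).nontriv) :
    (HOL.RTm.app (.lam (vUnk D X) (φ.tr D)) (lams (restr D P) (r.tr D))).ABeq
      ((φ.subst (.single X r hr)).tr D) := by
  induction φ with
  | bot => exact HOL.RTm.redex_of_notMem_fv _ fun h => h.elim
  | imp φ ψ ih ih' =>
    refine .trans (HOL.RTm.redex_app _ _ _ _) (.app (.trans (HOL.RTm.redex_app _ _ _ _)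
      (.app ?_ (ih hφ.1 hb.1))) (ih' hφ.2 hb.2))
    exact HOL.RTm.redex_of_notMem_fv _ fun h => h.elim
  | pred Q s =>
    exact .trans (HOL.RTm.redex_app _ _ _ _) (.app (HOL.RTm.redex_of_notMem_fv _ fun h => h.elim)
      (RTerm.redex_tr_abeq_tr_subst D X r hr s A hφ))
  | @all α' P' Y φ ih =>
    by_cases hY : (⟨α', P', Y⟩ : S.Unknown) = ⟨α, P, X⟩
    · cases hY
      -- A quantified `X` outside `nontriv` forces the substitution to be trivial up to
      -- α-equivalence.
      have h : r.Aeq (.unk 1 X) := by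
        by_contra h
        exact hb.1 (Or.inl (by rwa [Subst.single_self]))
      refine .trans (HOL.RTm.redex_of_notMem_fv _ fun h' => ?_)
        (.alpha (RForm.tr_subst_single_aeq D X r hr h (.all X φ)).symm)
      exact (RForm.fU_of_mem_fv_tr D (.all X φ) _ h' _ rfl).2 rfl
    · refine .trans (HOL.RTm.redex_app _ _ _ _)
        (.app (HOL.RTm.redex_of_notMem_fv _ fun h => h.elim)
          (.trans (HOL.RTm.redex_lam _ (fun h => ?_) fun h => ?_) (.lam (ih hφ hb.2))))
      · exact hY (HVar.unk.inj (underlying_eq h)).1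
      · have hr' := RTerm.fU_of_mem_fv_tr D r _ ((mem_fv_lams _ _ _).1 h).1 ⟨α', P', Y⟩ rfl
        -- A bound `Y` free in `r` would be an unknown produced by the substitution, the second way
        -- of being in `nontriv`.
        exact hb.1 (Or.inr ⟨⟨α, P, X⟩, Ne.symm hY, by rwa [Subst.single_self]⟩)

/-! ### Soundness -/

theorem Form.notMem_fv_of_mem_image_tr (D : List S.Atom) {α : S.Sort'} {P : S.Perms}
    (X : S.Unk α P) {Φ : Set (Form S)} (hΦ : ∀ χ ∈ Φ, (⟨α, P, X⟩ : S.Unknown) ∉ χ.fU)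
    (χ : HOL.Form S.hol) (hχ : χ ∈ Form.tr D '' Φ) :
    (⟨_, vUnk D X⟩ : S.hol.Variable) ∉ χ.fv := by
  obtain ⟨φ, hφ, rfl⟩ := hχ
  have h := hΦ φ hφ
  induction φ using Quotient.inductionOn with
  | h φ => exact fun h' => h (RForm.fU_of_mem_fv_tr D φ _ h' _ rfl)

theorem Form.tr_imp (D : List S.Atom) (φ ψ : Form S) :
    (Form.imp φ ψ).tr D = HOL.Form.imp (φ.tr D) (ψ.tr D) := by
  induction φ using Quotient.inductionOn
  induction ψ using Quotient.inductionOn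
  rfl

theorem Form.tr_all (D : List S.Atom) {α : S.Sort'} {P : S.Perms} (X : S.Unk α P) (φ : Form S) :
    (Form.all X φ).tr D = HOL.Form.all (vUnk D X) (φ.tr D) := by
  induction φ using Quotient.inductionOn
  rfl

theorem Deriv.derivable_tr {Φ Ψ : Set (Form S)} (B : Deriv Φ Ψ) (D : List S.Atom)
    (h : ∀ s ∈ B.sequents, CaptSet D s.1 ∧ CaptSet D s.2) :
    HOL.Derivable (Form.tr D '' Φ) (Form.tr D '' Ψ) := by
  induction B with
  | ax Φ Ψ φ =>
    simp only [Set.image_insert_eq]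
    exact .ax _ _ _
  | botL Φ Ψ =>
    simp only [Set.image_insert_eq]
    exact .botL _ _
  | impL Φ Ψ φ ψ B B' ih ih' =>
    have h1 := ih fun s hs => h s (Or.inr (Or.inl hs))
    have h2 := ih' fun s hs => h s (Or.inr (Or.inr hs))
    simp only [Set.image_insert_eq, Form.tr_imp] at h1 h2 ⊢
    exact .impL _ _ _ _ h1 h2
  | impR Φ Ψ φ ψ B ih =>
    have h1 := ih fun s hs => h s (Or.inr hs)
    simp only [Set.image_insert_eq, Form.tr_imp] at h1 ⊢
    exact .impR _ _ _ _ h1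
  | @allL Φ Ψ α P X φ r hr hφ B ih =>
    have h1 := ih fun s hs => h s (Or.inr hs)
    -- Capture typing of `∀X.φ`, taken in the conclusion of this rule, is by definition that of `φ`.
    have hc : φ.Capt D ∅ := (h _ (Or.inl rfl)).1 _ (Set.mem_insert _ _)
    simp only [Set.image_insert_eq, Form.tr_all] at h1 ⊢
    obtain ⟨ξ, hξ, hξ'⟩ :=
      (φ.tr D).exists_aeq_canSubst (vUnk D X) (lams (restr D P) (r.tr D))
    have hcls : Form.tr D φ.cls = ξ.cls := Quotient.sound hξ
    rw [hcls]
    -- The induction hypothesis concerns `⟦φ[X := r]⟧`; conversion on the left turns it into the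
    -- instance of the representative `ξ`, the β-redex being the intermediate term.
    refine .allL _ _ (vUnk D X) ξ _ hξ' (.convL _ _ _ _ ?_ h1)
    exact .trans (RForm.redex_tr_abeq_tr_subst D X r hr φ ∅ hc hφ).symm
      (HOL.RTm.redex_abeq_subst hξ hξ')
  | allR Φ Ψ X φ hΦ hΨ B ih =>
    have h1 := ih fun s hs => h s (Or.inr hs)
    simp only [Set.image_insert_eq, Form.tr_all] at h1 ⊢
    exact .allR _ _ _ _ (Form.notMem_fv_of_mem_image_tr D X hΦ)
      (Form.notMem_fv_of_mem_image_tr D X hΨ) h1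

/-! ### Existence of capture-typing lists -/

theorem AtomPerm.nontriv_finite (π : AtomPerm S) : π.nontriv.Finite := by
  refine Set.Finite.subset π.2 fun a ha h => ha ?_
  exact Sigma.ext rfl (heq_of_eq h)

/-- Quantifying over all lists containing `F` lets the sets found for subterms be combined by union.
Finiteness survives the infinite permission sets because only `π.nontriv ∪ A` is needed at an
unknown, and each abstraction adds one atom to `A`. -/
theorem RTerm.exists_finite_capt {α : S.Sort'} (r : RTerm S α) {A : Set S.Atom}
    (hA : A.Finite) : ∃ F : Set S.Atom, F.Finite ∧
      ∀ D : List S.Atom, (∀ a ∈ F, a ∈ D) → r.Capt D A := by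
  induction r generalizing A with
  | atom a => exact ⟨∅, Set.finite_empty, fun _ _ => trivial⟩
  | tuple rs ih =>
    choose F hF h using fun i => ih i hA
    exact ⟨⋃ i, F i, Set.finite_iUnion hF, fun D hD i =>
      h i D fun a ha => hD a (Set.mem_iUnion.2 ⟨i, ha⟩)⟩
  | app f r ih => exact ih hA
  | abs a r ih => exact ih (hA.insert _)
  | unk π X => exact ⟨π.nontriv ∪ A, π.nontriv_finite.union hA, fun D hD a ha => hD a ha.1⟩

theorem RForm.exists_finite_capt (φ : RForm S) {A : Set S.Atom} (hA : A.Finite) :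
    ∃ F : Set S.Atom, F.Finite ∧ ∀ D : List S.Atom, (∀ a ∈ F, a ∈ D) → φ.Capt D A := by
  induction φ with
  | bot => exact ⟨∅, Set.finite_empty, fun _ _ => trivial⟩
  | imp φ ψ ih ih' =>
    obtain ⟨F, hF, h⟩ := ih
    obtain ⟨F', hF', h'⟩ := ih'
    exact ⟨F ∪ F', hF.union hF', fun D hD =>
      ⟨h D fun a ha => hD a (Or.inl ha), h' D fun a ha => hD a (Or.inr ha)⟩⟩
  | pred Q r => exact r.exists_finite_capt hA
  | all X φ ih => exact ih

theorem exists_finite_captSet {Φ : Set (Form S)} (hΦ : Φ.Finite) :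
    ∃ F : Set S.Atom, F.Finite ∧ ∀ D : List S.Atom, (∀ a ∈ F, a ∈ D) → CaptSet D Φ := by
  have h : ∀ φ : Form S, ∃ F : Set S.Atom, F.Finite ∧
      ∀ D : List S.Atom, (∀ a ∈ F, a ∈ D) → φ.Capt D ∅ := fun φ =>
    Quotient.inductionOn φ fun φ => φ.exists_finite_capt Set.finite_empty
  choose F hF h using h
  exact ⟨⋃ φ ∈ Φ, F φ, hΦ.biUnion fun φ _ => hF φ, fun D hD φ hφ =>
    h φ D fun a ha => hD a (Set.mem_biUnion hφ ha)⟩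

theorem exists_finite_capt_insert_sequents {Φ Ψ : Set (Form S)} (hΦ : Φ.Finite) (hΨ : Ψ.Finite)
    {𝒮 : Set (Set (Form S) × Set (Form S))}
    (h : ∃ F : Set S.Atom, F.Finite ∧ ∀ D : List S.Atom, (∀ a ∈ F, a ∈ D) →
      ∀ s ∈ 𝒮, CaptSet D s.1 ∧ CaptSet D s.2) :
    ∃ F : Set S.Atom, F.Finite ∧ ∀ D : List S.Atom, (∀ a ∈ F, a ∈ D) →
      ∀ s ∈ insert (Φ, Ψ) 𝒮, CaptSet D s.1 ∧ CaptSet D s.2 := by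
  obtain ⟨F, hF, h⟩ := h
  obtain ⟨F₁, hF₁, h₁⟩ := exists_finite_captSet hΦ
  obtain ⟨F₂, hF₂, h₂⟩ := exists_finite_captSet hΨ
  refine ⟨F ∪ (F₁ ∪ F₂), hF.union (hF₁.union hF₂), fun D hD s hs => ?_⟩
  rcases hs with rfl | hs
  · exact ⟨h₁ D fun a ha => hD a (Or.inr (Or.inl ha)),
      h₂ D fun a ha => hD a (Or.inr (Or.inr ha))⟩
  · exact h D (fun a ha => hD a (Or.inl ha)) s hs

/-- Finiteness passes from conclusion to premises: the contexts of a premise are subsets of the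
conclusion's sides, with at most one proposition inserted on each. -/
theorem Deriv.exists_finite_capt {Φ Ψ : Set (Form S)} (B : Deriv Φ Ψ) (hΦ : Φ.Finite)
    (hΨ : Ψ.Finite) : ∃ F : Set S.Atom, F.Finite ∧ ∀ D : List S.Atom, (∀ a ∈ F, a ∈ D) →
      ∀ s ∈ B.sequents, CaptSet D s.1 ∧ CaptSet D s.2 := by
  have hempty : ∃ F : Set S.Atom, F.Finite ∧ ∀ D : List S.Atom, (∀ a ∈ F, a ∈ D) →
      ∀ s ∈ (∅ : Set (Set (Form S) × Set (Form S))), CaptSet D s.1 ∧ CaptSet D s.2 :=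
    ⟨∅, Set.finite_empty, fun _ _ _ hs => hs.elim⟩
  induction B with
  | ax Φ Ψ φ =>
    -- The single sequent of a leaf is treated as inserted into the empty set.
    simpa only [Deriv.sequents, insert_empty_eq] using
      exists_finite_capt_insert_sequents hΦ hΨ hempty
  | botL Φ Ψ =>
    simpa only [Deriv.sequents, insert_empty_eq] using
      exists_finite_capt_insert_sequents hΦ hΨ hempty
  | impL Φ Ψ φ ψ B B' ih ih' =>
    have hΦ' := hΦ.subset (Set.subset_insert _ _)
    obtain ⟨F, hF, h⟩ := ih hΦ' (hΨ.insert _)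
    obtain ⟨F', hF', h'⟩ := ih' (hΦ'.insert _) hΨ
    refine exists_finite_capt_insert_sequents hΦ hΨ
      ⟨F ∪ F', hF.union hF', fun D hD s hs => hs.elim ?_ ?_⟩
    · exact h D (fun a ha => hD a (Or.inl ha)) s
    · exact h' D (fun a ha => hD a (Or.inr ha)) s
  | impR Φ Ψ φ ψ B ih =>
    exact exists_finite_capt_insert_sequents hΦ hΨ
      (ih (hΦ.insert _) ((hΨ.subset (Set.subset_insert _ _)).insert _))
  | allL Φ Ψ X φ r hr hφ B ih =>
    exact exists_finite_capt_insert_sequents hΦ hΨ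
      (ih ((hΦ.subset (Set.subset_insert _ _)).insert _) hΨ)
  | allR Φ Ψ X φ h h' B ih =>
    exact exists_finite_capt_insert_sequents hΦ hΨ
      (ih hΦ ((hΨ.subset (Set.subset_insert _ _)).insert _))

end PNL

theorem mainTheorem2 (S : PNL.Signature.{u}) (Φ Ψ : Set (PNL.Form S)) (B : PNL.Deriv Φ Ψ) :
    (∀ D : List S.Atom, D.Nodup →
      (∀ s ∈ B.sequents, PNL.CaptSet D s.1 ∧ PNL.CaptSet D s.2) →
        HOL.Derivable (PNL.Form.tr D '' Φ) (PNL.Form.tr D '' Ψ)) ∧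
    (Φ.Finite → Ψ.Finite → ∃ D : List S.Atom, D.Nodup ∧
      ∀ s ∈ B.sequents, PNL.CaptSet D s.1 ∧ PNL.CaptSet D s.2) := by
  refine ⟨fun D _ h => B.derivable_tr D h, fun hΦ hΨ => ?_⟩
  obtain ⟨F, hF, h⟩ := B.exists_finite_capt hΦ hΨ
  exact ⟨hF.toFinset.toList, Finset.nodup_toList _, h _ fun a ha => by simpa using ha⟩
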